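/- Let $\mathcal Z=\{0,1,2,\dots\}$, let $\mathcal M_1(\mathcal Z)$ be the set of probability measures on $\mathcal Z$ with the total variation metric $d$, and put $\vartheta(z)=z\log z$ (with $0\log 0=0$) and $\langle \xi,\vartheta\rangle=\sum_z \xi(z)\vartheta(z)\in[0,\infty]$. Let $\mathscr K=\{\xi\in\mathcal M_1(\mathcal Z):\langle\xi,\vartheta\rangle<\infty\}$. Let $\mathcal E=\{(z,z+1):z\in\mathcal Z\}\cup\{(z,0):z\in\mathcal Z\setminus\{0\}\}$, and let $\lambda_{z,z'}:\mathcal M_1(\mathcal Z)\to\mathbb R_+$, $(z,z')\in\mathcal E$, be such that - there are constants $\underline\lambda,\overline\lambda>0$ with $\frac{\underline\lambda}{z+1}\le\lambda_{z,z+1}(\xi)\le\frac{\overline\lambda}{z+1}$ for all $z\in\mathcal Z$, and $\underline\lambda\le\lambda_{z,0}(\xi)\le\overline\lambda$ for all $z\ge1$, for every $\xi\in\mathcal M_1(\mathcal Z)$; - the functions $(z+1)\lambda_{z,z+1}(\cdot)$, $z\in\mathcal Z$, and $\lambda_{z,0}(\cdot)$, $z\geq 1$, are Lipschitz with respect to $d$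 with a common constant. Let $\Lambda_\xi$ be the rate matrix with off-diagonal entries $\lambda_{z,z'}(\xi)$ for $(z,z')\in\mathcal E$, $0$ otherwise, and zero row sums, and let $\Lambda_\xi^*$ be its transpose. For $\nu\in\mathcal M_1(\mathcal Z)$ let $\mu_\nu$ denote the solution of the McKean–Vlasov equation $\dot\mu(t)=\Lambda^*_{\mu(t)}\mu(t)$, $\mu(0)=\nu$, $t\ge0$. Assume that this equation has a unique globally asymptotically stable equilibrium $\xi^*$ (an equilibrium that is Lyapunov stable and to which all solutions converge, with respect to $d$), that $\langle\xi^*,\vartheta\rangle<\infty$, and that for every $M>0$ $$\lim_{t\to\infty}\ \sup_{\nu:\,\langle\nu,\vartheta\rangle\le M}\langle\mu_\nu(t),\vartheta\rangle=\langle\xi^*,\vartheta\rangle .$$ Let $\tau(u)=e^u-u-1$. For $T>0$ and a path $\varphi:[0,T]\to\mathcal M_1(\mathcal Z)$ with $\varphi(0)=\nu$ all of whose coordinates $t\mapsto\varphi_t(z)$ are absolutely continuous, let $$S_{[0,T]}(\varphi|\nu)=\int_0^T\sup_{\alpha}\Big\{\sum_z\alpha(z)\big(\dot\varphi_t(z)-(\Lambda^*_{\varphi_t}\varphi_t)(z)\big)-\sum_{(z,z')\in\mathcal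 E}\tau(\alpha(z')-\alpha(z))\,\lambda_{z,z'}(\varphi_t)\,\varphi_t(z)\Big\}\,dt ,$$ where the supremum is over all finitely supported $\alpha:\mathcal Z\to\mathbb R$; let $S_{[0,T]}(\varphi|\nu)=\infty$ for all other paths. Define the quasipotential $$V(\xi)=\inf\{S_{[0,T]}(\varphi|\xi^*):T>0,\ \varphi(0)=\xi^*,\ \varphi(T)=\xi\}\in[0,\infty],\qquad \xi\in\mathcal M_1(\mathcal Z).$$ Then: 1. If $\xi_n\in\mathscr K$ for all $n$, $\xi\in\mathscr K$, $d(\xi_n,\xi)\to0$ and $\langle\xi_n,\vartheta\rangle\to\langle\xi,\vartheta\rangle$ as $n\to\infty$, then $V(\xi_n)\to V(\xi)$ as $n\to\infty$. 2. (Small cost connection from $\xi^*$ to nearby points.) $V(\xi^*)=0$, and there is $T>0$ such that for every $\gamma>0$ there is $\Delta>0$ with the following property: for every $\zeta\in\mathscr K$ with $d(\xi^*,\zeta)\le\Delta$ and $|\langle\xi^*,\vartheta\rangle-\langle\zeta,\vartheta\rangle|\le\Delta$ there is a path $\varphi$ on $[0,T]$ with $\varphi(0)=\xi^*$, $\varphi(T)=\zeta$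 and $S_{[0,T]}(\varphi|\xi^*)\le\gamma$. -/

import Mathlib

open Filter Topology MeasureTheory
open scoped NNReal ENNReal

namespace MeanField

/-- The directed edges of the graph on the nonnegative integers: forward edges `(z, z + 1)` for
every `z`, and backward edges `(z, 0)` for every `z ≠ 0`. -/
def edges : Set (ℕ × ℕ) :=
  {e | e.2 = e.1 + 1 ∨ (e.1 ≠ 0 ∧ e.2 = 0)}

/-- The mass `ξ(z)` of a probability measure `ξ` on the nonnegative integers, as a real number. -/
noncomputable def mass (ξ : PMF ℕ) (z : ℕ) : ℝ := (ξ z).toReal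

/-- The total variation distance `sup_A |ξ(A) - ζ(A)| = (1/2) ∑ |ξ(z) - ζ(z)|`. -/
noncomputable def tvDist (ξ ζ : PMF ℕ) : ℝ := (1 / 2) * ∑' z, |mass ξ z - mass ζ z|

/-- The function `ϑ(z) = z log z`, with `0 log 0 = 0`. -/
noncomputable def theta (z : ℕ) : ℝ := (z : ℝ) * Real.log z

/-- The `ϑ`-moment `⟨ξ, ϑ⟩`, with values in `[0, ∞]` (note that `ϑ ≥ 0`). -/
noncomputable def thetaMoment (ξ : PMF ℕ) : ℝ≥0∞ := ∑' z, ξ z * ENNReal.ofReal (theta z)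

/-- The set of probability measures with finite `ϑ`-moment. -/
def finiteMoment : Set (PMF ℕ) := {ξ | thetaMoment ξ < ∞}

/-- The set `K(Δ)` around `ξs`: the measures with finite `ϑ`-moment that are within `Δ` of `ξs`
both in total variation and in `ϑ`-moment. -/
def nbhd (ξs : PMF ℕ) (Δ : ℝ) : Set (PMF ℕ) :=
  {ξ | ξ ∈ finiteMoment ∧ tvDist ξs ξ ≤ Δ ∧
    |(thetaMoment ξs).toReal - (thetaMoment ξ).toReal| ≤ Δ}

/-! Transition rates: `lam z z' ξ` is the rate of the jump `z → z'` along an edge `(z, z')` when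
the empirical measure is `ξ`.  Values of `lam` off the edges are never used. -/

/-- Forward rates between positive multiples of `1 / (z + 1)`, backward rates between positive
constants, uniformly in the measure. -/
def RateBounds (lam : ℕ → ℕ → PMF ℕ → ℝ) : Prop :=
  ∃ lo hi : ℝ, 0 < lo ∧ 0 < hi ∧ ∀ ξ : PMF ℕ,
    (∀ z : ℕ, lo / (z + 1) ≤ lam z (z + 1) ξ ∧ lam z (z + 1) ξ ≤ hi / (z + 1)) ∧
    (∀ z : ℕ, z ≠ 0 → lo ≤ lam z 0 ξ ∧ lam z 0 ξ ≤ hi)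

/-- The functions `(z + 1) λ_{z,z+1}` and `λ_{z,0}` are Lipschitz in total variation, with one
constant for all `z`. -/
def RateLipschitz (lam : ℕ → ℕ → PMF ℕ → ℝ) : Prop :=
  ∃ L : ℝ, ∀ ξ ζ : PMF ℕ,
    (∀ z : ℕ, |((z : ℝ) + 1) * lam z (z + 1) ξ - ((z : ℝ) + 1) * lam z (z + 1) ζ|
      ≤ L * tvDist ξ ζ) ∧
    (∀ z : ℕ, z ≠ 0 → |lam z 0 ξ - lam z 0 ζ| ≤ L * tvDist ξ ζ)

open Classical in
/-- The rate matrix `Λ_ξ`. -/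
noncomputable def rateMatrix (lam : ℕ → ℕ → PMF ℕ → ℝ) (ξ : PMF ℕ) (z z' : ℕ) : ℝ :=
  if (z, z') ∈ edges then lam z z' ξ
  else if z = z' then -∑' y, (if (z, y) ∈ edges then lam z y ξ else 0)
  else 0

/-- The vector `Λ_ξ^* ξ`, that is `z' ↦ ∑_z Λ_ξ(z, z') ξ(z)`. -/
noncomputable def drift (lam : ℕ → ℕ → PMF ℕ → ℝ) (ξ : PMF ℕ) (z' : ℕ) : ℝ :=
  ∑' z, rateMatrix lam ξ z z' * mass ξ z

/-- `μ` solves the McKean–Vlasov equation `μ'(t) = Λ_{μ(t)}^* μ(t)`, `μ(0) = ν`, on `[0, ∞)`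
(the values of `μ` at negative times are irrelevant). -/
def IsMcKeanVlasov (lam : ℕ → ℕ → PMF ℕ → ℝ) (ν : PMF ℕ) (μ : ℝ → PMF ℕ) : Prop :=
  μ 0 = ν ∧ ∀ t : ℝ, 0 ≤ t → ∀ z : ℕ,
    HasDerivWithinAt (fun s => mass (μ s) z) (drift lam (μ t) z) (Set.Ici 0) t

/-- `ξs` is a globally asymptotically stable equilibrium of the McKean–Vlasov equation: it is an
equilibrium, it is Lyapunov stable, and every solution converges to it. -/
def IsGloballyAsymptoticallyStable (lam : ℕ → ℕ → PMF ℕ → ℝ) (ξs : PMF ℕ) : Prop :=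
  (∀ z, drift lam ξs z = 0) ∧
  (∀ ε : ℝ, 0 < ε → ∃ δ : ℝ, 0 < δ ∧ ∀ (ν : PMF ℕ) (μ : ℝ → PMF ℕ), tvDist ν ξs < δ →
    IsMcKeanVlasov lam ν μ → ∀ t : ℝ, 0 ≤ t → tvDist (μ t) ξs < ε) ∧
  (∀ (ν : PMF ℕ) (μ : ℝ → PMF ℕ), IsMcKeanVlasov lam ν μ →
    Tendsto (fun t => tvDist (μ t) ξs) atTop (𝓝 0))

/-- `ξs` is the unique globally asymptotically stable equilibrium. -/
def IsUniqueStableEquilibrium (lam : ℕ → ℕ → PMF ℕ → ℝ) (ξs : PMF ℕ) : Prop :=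
  IsGloballyAsymptoticallyStable lam ξs ∧
    ∀ ζ : PMF ℕ, IsGloballyAsymptoticallyStable lam ζ → ζ = ξs

/-- `ξs` has finite `ϑ`-moment, and for each `M > 0` the supremum of the `ϑ`-moments at time `t`
of the solutions that start from a measure with `ϑ`-moment at most `M` converges to that of `ξs`
as `t → ∞`. -/
def MomentConvergence (lam : ℕ → ℕ → PMF ℕ → ℝ) (ξs : PMF ℕ) : Prop :=
  thetaMoment ξs < ∞ ∧ ∀ M : ℝ≥0, 0 < M →
    Tendsto (fun t : ℝ => ⨆ (ν : PMF ℕ) (_ : thetaMoment ν ≤ M) (μ : ℝ → PMF ℕ)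
      (_ : IsMcKeanVlasov lam ν μ), thetaMoment (μ t)) atTop (𝓝 (thetaMoment ξs))

/-- `τ(u) = e^u - u - 1`. -/
noncomputable def tau (u : ℝ) : ℝ := Real.exp u - u - 1

/-- The expression
`⟨α, v - Λ_ξ^* ξ⟩ - ∑_{(z,z') ∈ edges} τ(α(z') - α(z)) λ_{z,z'}(ξ) ξ(z)`
for a finitely supported function `α`, a measure `ξ` and a velocity `v`. -/
noncomputable def localFunctional (lam : ℕ → ℕ → PMF ℕ → ℝ) (ξ : PMF ℕ) (v : ℕ → ℝ)
    (α : ℕ →₀ ℝ) : ℝ :=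
  (α.sum fun z a => a * (v z - drift lam ξ z)) -
    ∑' e : edges, tau (α e.1.2 - α e.1.1) * lam e.1.1 e.1.2 ξ * mass ξ e.1.1

/-- The supremum of `localFunctional` over all finitely supported `α`, as an element of `[0, ∞]`.
Since `α = 0` gives the value `0`, truncating at `0` does not change the supremum. -/
noncomputable def localCost (lam : ℕ → ℕ → PMF ℕ → ℝ) (ξ : PMF ℕ) (v : ℕ → ℝ) : ℝ≥0∞ :=
  ⨆ α : ℕ →₀ ℝ, ENNReal.ofReal (localFunctional lam ξ v α)

/-- Absolute continuity on `[0, T]` of a path of measures, tested on finitely supported functions;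
equivalently, every coordinate is absolutely continuous.  Such a path is continuous in total
variation (Scheffé), hence in particular right continuous with left limits. -/
def IsAbsCont (T : ℝ) (φ : ℝ → PMF ℕ) : Prop :=
  ∀ z : ℕ, AbsolutelyContinuousOnInterval (fun t => mass (φ t) z) 0 T

open Classical in
/-- The cost `S_{[0,T]}(φ | ν)`: the time integral of the local cost along `φ` if `φ(0) = ν` and
`φ` is absolutely continuous on `[0, T]`, and `∞` otherwise.  Only the values of `φ` on `[0, T]`
matter (the derivative at the two endpoints is irrelevant for the integral). -/
noncomputable def pathCost (lam : ℕ → ℕ → PMF ℕ → ℝ) (T : ℝ) (φ : ℝ → PMF ℕ) (ν : PMF ℕ) :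
    ℝ≥0∞ :=
  if φ 0 = ν ∧ IsAbsCont T φ then
    ∫⁻ t in Set.Icc 0 T, localCost lam (φ t) (fun z => deriv (fun s => mass (φ s) z) t)
  else ∞

/-- The Freidlin–Wentzell quasipotential `V(ξ)` relative to `ξs`. -/
noncomputable def quasipotential (lam : ℕ → ℕ → PMF ℕ → ℝ) (ξs ξ : PMF ℕ) : ℝ≥0∞ :=
  ⨅ (T : ℝ) (_ : 0 < T) (φ : ℝ → PMF ℕ) (_ : φ 0 = ξs) (_ : φ T = ξ), pathCost lam T φ ξs

end MeanField

namespace MeanField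

/-! Any two measures `ξ`, `ζ` are joined in time `2t` at a cost of at most `C(t) * excess ξ ζ + 4 *
hi * t` (`exists_path_pathCost_le`). The common part `min ξ ζ` stays put; the surplus of `ξ` is sent
to `0` along backward edges, and the missing part of `ζ` is then built up from `0` along forward
edges.

The cost is estimated by `localCost_divergence_le`: a velocity that is the divergence of a flux
costs at most flux times the logarithm of a bound for its ratio to the natural flux, plus a
constant. Forward rates are of order `1 / (z + 1)`, so lifting unit mass to `n` costs about `∑ log
z` over `z ≤ n`, hence of order `n log n`: this is where `theta` comes from.

Near a measure of finite moment, in total variation and in moment, the excess is small in both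
directions (`exists_nbhd_excess_le`). Choosing `t` first and the neighbourhood afterwards makes the
connection cost arbitrarily small. Concatenation gives a triangle inequality for the quasipotential,
and connections in both directions give its continuity. At the equilibrium, waiting is free, so all
connecting times can be padded to `1`. -/

theorem mass_nonneg (ξ : PMF ℕ) (z : ℕ) : 0 ≤ mass ξ z := ENNReal.toReal_nonneg

theorem ofReal_mass (ξ : PMF ℕ) (z : ℕ) : ENNReal.ofReal (mass ξ z) = ξ z :=
  ENNReal.ofReal_toReal (ξ.apply_ne_top z)

theorem hasSum_mass (ξ : PMF ℕ) : HasSum (mass ξ) 1 := by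
  have h : Summable (mass ξ) := ENNReal.summable_toReal ξ.tsum_coe_ne_top
  have : ∑' z, mass ξ z = 1 := by
    simp only [mass]
    rw [← ENNReal.tsum_toReal_eq (fun z => ξ.apply_ne_top z), ξ.tsum_coe, ENNReal.toReal_one]
  exact this ▸ h.hasSum

theorem summable_mass (ξ : PMF ℕ) : Summable (mass ξ) := (hasSum_mass ξ).summable

/-! ### Fluxes, divergences and the drift -/

/-- The net inflow at `z` of a mass flux with rate `p y` from `y` to `y + 1` and rate `q y` from
`y` to `0`. -/
noncomputable def divergence (p q : ℕ → ℝ) (z : ℕ) : ℝ :=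
  (if z = 0 then ∑' y, q y else p (z - 1)) - p z - q z

/-- The flux from `z` to `z + 1` of the mean-field dynamics. -/
noncomputable def upFlux (lam : ℕ → ℕ → PMF ℕ → ℝ) (ξ : PMF ℕ) (z : ℕ) : ℝ :=
  lam z (z + 1) ξ * mass ξ z

/-- The flux from `z` to `0` of the mean-field dynamics. -/
noncomputable def downFlux (lam : ℕ → ℕ → PMF ℕ → ℝ) (ξ : PMF ℕ) (z : ℕ) : ℝ :=
  if z = 0 then 0 else lam z 0 ξ * mass ξ z

/-- Summation by parts along the edges. No summability of `p` is needed, since `α (z + 1) - α z`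
vanishes for large `z`; `q` is weighted by `α 0` however large `z` is. -/
theorem hasSum_sum_mul_divergence (α : ℕ →₀ ℝ) (p : ℕ → ℝ) {q : ℕ → ℝ} (hq : Summable q) :
    HasSum (fun z => (α (z + 1) - α z) * p z + (α 0 - α z) * q z)
      (α.sum fun z a => a * divergence p q z) := by
  have hfin : ∀ f : ℕ → ℝ, HasSum (fun z => α z * f z) (∑ z ∈ α.support, α z * f z) := fun f =>
    hasSum_sum_of_ne_finset_zero fun z hz => by simp [Finsupp.notMem_support_iff.mp hz]
  have h1 := hfin (divergence p q)
  have h6 := hfin fun z => if z = 0 then 0 else p (z - 1)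
  have h2 : HasSum (fun z => α (z + 1) * p z)
      (∑' z, α z * (if z = 0 then 0 else p (z - 1))) := by
    have := (hasSum_nat_add_iff' 1).mpr h6.summable.hasSum
    simpa using this
  have h3 := hfin p
  have h4 := hfin q
  have h5 := hq.hasSum.mul_left (α 0)
  have h7 : HasSum (fun z => α z * (if z = 0 then ∑' y, q y else 0)) (α 0 * ∑' y, q y) := by
    convert hasSum_single 0 fun z hz => ?_ using 1
    · simp
    · simp [hz]
  have h8 : HasSum (fun z => α z * divergence p q z)
      (α 0 * (∑' y, q y) + (∑' z, α z * (if z = 0 then 0 else p (z - 1)))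
        - (∑ z ∈ α.support, α z * p z) - (∑ z ∈ α.support, α z * q z)) := by
    refine (((h7.add h6.summable.hasSum).sub h3).sub h4).congr_fun ?_
    intro z
    unfold divergence
    split_ifs <;> ring
  have h9 := h1.unique h8
  rw [Finsupp.sum, h9, show ∀ a b c d : ℝ, a + b - c - d = (b - c) + (a - d) by intros; ring]
  refine ((h2.sub h3).add (h5.sub h4)).congr_fun fun z => ?_
  ring

theorem tsum_rate_out (lam : ℕ → ℕ → PMF ℕ → ℝ) (ξ : PMF ℕ) (z : ℕ)
    [∀ y, Decidable ((z, y) ∈ edges)] :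
    ∑' y, (if (z, y) ∈ edges then lam z y ξ else 0)
      = lam z (z + 1) ξ + if z = 0 then 0 else lam z 0 ξ := by
  rw [tsum_eq_sum (s := {z + 1, 0})]
  · rw [Finset.sum_pair (by simp)]
    simp [edges]
  · intro y hy
    simp only [Finset.mem_insert, Finset.mem_singleton, not_or] at hy
    simp [edges, hy]

theorem rateMatrix_mul_mass (lam : ℕ → ℕ → PMF ℕ → ℝ) (ξ : PMF ℕ) (z z' : ℕ) :
    rateMatrix lam ξ z z' * mass ξ z =
      (if z' = z + 1 then upFlux lam ξ z else 0) + (if z' = 0 then downFlux lam ξ z else 0)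
        - (if z = z' then upFlux lam ξ z + downFlux lam ξ z else 0) := by
  unfold rateMatrix
  rw [tsum_rate_out]
  unfold upFlux downFlux edges
  by_cases h1 : z' = z + 1
  · subst h1
    simp
  by_cases h2 : z' = 0
  · subst h2
    by_cases h3 : z = 0
    · subst h3
      simp
    · simp [h3]
  · by_cases h3 : z = z'
    · subst h3
      simp [h2]
      ring
    · simp [h1, h2, h3]

theorem drift_eq_divergence (lam : ℕ → ℕ → PMF ℕ → ℝ) (ξ : PMF ℕ)
    (hd : Summable (downFlux lam ξ)) :
    drift lam ξ = divergence (upFlux lam ξ) (downFlux lam ξ) := by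
  ext z'
  unfold drift
  simp only [rateMatrix_mul_mass]
  have h3 : HasSum (fun z => if z = z' then upFlux lam ξ z + downFlux lam ξ z else 0)
      (upFlux lam ξ z' + downFlux lam ξ z') := by
    have := hasSum_ite_eq z' (upFlux lam ξ z' + downFlux lam ξ z')
    refine this.congr_fun fun z => ?_
    split_ifs with h
    · rw [h]
    · rfl
  rcases Nat.eq_zero_or_pos z' with rfl | hz
  · have := (hd.hasSum.sub h3).tsum_eq
    simp only [divergence, if_true]
    simp only [zero_add, (Nat.succ_ne_zero _).symm, if_false]
    rw [this]
    ring
  · obtain ⟨w, rfl⟩ : ∃ w, z' = w + 1 := ⟨z' - 1, by omega⟩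
    have h1 : HasSum (fun z => if w + 1 = z + 1 then upFlux lam ξ z else 0) (upFlux lam ξ w) := by
      refine (hasSum_ite_eq w (upFlux lam ξ w)).congr_fun fun z => ?_
      by_cases h : z = w
      · simp [h]
      · simp [h, Ne.symm h]
    have := (h1.sub h3).tsum_eq
    simp only [divergence, Nat.add_eq_zero_iff, one_ne_zero, and_false, if_false, add_zero,
      Nat.add_sub_cancel]
    rw [this]
    ring

/-- Forward and backward edges are disjoint because a forward edge never ends at `0`. -/
theorem hasSum_edges {f : ℕ × ℕ → ℝ} {a b : ℝ} (hup : HasSum (fun z => f (z, z + 1)) a)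
    (hdown : HasSum (fun z => if z = 0 then 0 else f (z, 0)) b) :
    HasSum (fun e : edges => f e) (a + b) := by
  rw [show (fun e : edges => f e) = f ∘ (↑) from rfl, hasSum_subtype_iff_indicator]
  have hi : Function.Injective fun z : ℕ => (z, z + 1) := fun x y h => (Prod.mk.inj h).1
  have hj : Function.Injective fun z : ℕ => (z, 0) := fun x y h => (Prod.mk.inj h).1
  classical
  have h1 : HasSum (fun e : ℕ × ℕ => if e.2 = e.1 + 1 then f e else 0) a := by
    rw [← hi.hasSum_iff]
    · simpa [Function.comp_def] using hup
    · rintro ⟨x, y⟩ h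
      refine if_neg fun h' => h ⟨x, ?_⟩
      simp only at h'
      simp [h']
  have h2 : HasSum (fun e : ℕ × ℕ => if e.1 ≠ 0 ∧ e.2 = 0 then f e else 0) b := by
    rw [← hj.hasSum_iff]
    · refine hdown.congr_fun fun z => ?_
      by_cases h : z = 0 <;> simp [h]
    · rintro ⟨x, y⟩ h
      refine if_neg fun h' => h ⟨x, ?_⟩
      exact Prod.ext rfl h'.2.symm
  refine (h1.add h2).congr_fun fun e => ?_
  obtain ⟨x, y⟩ := e
  by_cases hy : y = 0
  · subst hy
    by_cases hx : x = 0 <;> simp [edges, Set.indicator, hx]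
  · by_cases hx : y = x + 1 <;> simp [edges, Set.indicator, hx, hy]

theorem summable_upFlux {lam : ℕ → ℕ → PMF ℕ → ℝ} {ξ : PMF ℕ} {lo hi : ℝ} (hlo : 0 < lo)
    (h : ∀ z : ℕ, lo / (z + 1) ≤ lam z (z + 1) ξ ∧ lam z (z + 1) ξ ≤ hi / (z + 1)) :
    Summable (upFlux lam ξ) ∧ ∑' z, upFlux lam ξ z ≤ hi := by
  have h0 : ∀ z, 0 ≤ upFlux lam ξ z := fun z =>
    mul_nonneg (le_trans (by positivity) (h z).1) (mass_nonneg ξ z)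
  have hhi : 0 ≤ hi := by
    have := (h 0).1.trans (h 0).2
    simp only [Nat.cast_zero, zero_add, div_one] at this
    linarith
  have h1 : ∀ z, upFlux lam ξ z ≤ hi * mass ξ z := fun z =>
    mul_le_mul_of_nonneg_right
      ((h z).2.trans (div_le_self hhi (by linarith [z.cast_nonneg (α := ℝ)])))
      (mass_nonneg ξ z)
  have h2 := (hasSum_mass ξ).mul_left hi
  have h3 := Summable.of_nonneg_of_le h0 h1 h2.summable
  exact ⟨h3, (h3.tsum_le_tsum h1 h2.summable).trans_eq (by rw [h2.tsum_eq, mul_one])⟩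

theorem summable_downFlux {lam : ℕ → ℕ → PMF ℕ → ℝ} {ξ : PMF ℕ} {lo hi : ℝ} (hlo : 0 < lo)
    (h : ∀ z : ℕ, z ≠ 0 → lo ≤ lam z 0 ξ ∧ lam z 0 ξ ≤ hi) :
    Summable (downFlux lam ξ) ∧ ∑' z, downFlux lam ξ z ≤ hi := by
  have hhi : 0 ≤ hi := by linarith [(h 1 one_ne_zero).1.trans (h 1 one_ne_zero).2]
  have h0 : ∀ z, 0 ≤ downFlux lam ξ z := fun z => by
    unfold downFlux
    split_ifs with hz
    · rfl
    · exact mul_nonneg (hlo.le.trans (h z hz).1) (mass_nonneg ξ z)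
  have h1 : ∀ z, downFlux lam ξ z ≤ hi * mass ξ z := fun z => by
    unfold downFlux
    split_ifs with hz
    · exact mul_nonneg hhi (mass_nonneg ξ z)
    · exact mul_le_mul_of_nonneg_right (h z hz).2 (mass_nonneg ξ z)
  have h2 := (hasSum_mass ξ).mul_left hi
  have h3 := Summable.of_nonneg_of_le h0 h1 h2.summable
  exact ⟨h3, (h3.tsum_le_tsum h1 h2.summable).trans_eq (by rw [h2.tsum_eq, mul_one])⟩

/-! ### The local cost of a flux -/

theorem tau_nonneg (u : ℝ) : 0 ≤ tau u := by
  unfold tau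
  linarith [Real.add_one_le_exp u]

theorem exists_abs_le (α : ℕ →₀ ℝ) : ∃ C, ∀ z, |α z| ≤ C := by
  obtain ⟨C, hC⟩ := (α.finite_range.image abs).bddAbove
  exact ⟨C, fun z => hC ⟨α z, ⟨z, rfl⟩, rfl⟩⟩

/-- The linear part of `tau` cancels the drift. Each edge then contributes `D * f - (exp D - 1) *
w`, with `f` the prescribed flux, `w` the natural one and `D` the increment of `α`, so edges can be
estimated one at a time. -/
theorem hasSum_localFunctional {lam : ℕ → ℕ → PMF ℕ → ℝ} {ξ : PMF ℕ} {p q : ℕ → ℝ}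
    (hq : Summable q) (hu : Summable (upFlux lam ξ)) (hd : Summable (downFlux lam ξ))
    (α : ℕ →₀ ℝ) :
    HasSum (fun z =>
      ((α (z + 1) - α z) * p z - (Real.exp (α (z + 1) - α z) - 1) * upFlux lam ξ z) +
      ((α 0 - α z) * q z - (Real.exp (α 0 - α z) - 1) * downFlux lam ξ z))
      (localFunctional lam ξ (divergence p q) α) := by
  obtain ⟨C, hC⟩ := exists_abs_le α
  have hbd : ∀ x y, |tau (α x - α y)| ≤ Real.exp (2 * C) + 2 * C := fun x y => by
    have hx := abs_le.mp (hC x)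
    have hy := abs_le.mp (hC y)
    rw [abs_of_nonneg (tau_nonneg _)]
    unfold tau
    have := Real.exp_le_exp.mpr (show α x - α y ≤ 2 * C by linarith)
    linarith
  have hsum : ∀ {w : ℕ → ℝ} {g : ℕ → ℝ}, Summable w → (∀ z, |g z| ≤ Real.exp (2 * C) + 2 * C) →
      Summable fun z => g z * w z := fun {w g} hw hg =>
    Summable.of_norm_bounded (hw.norm.mul_left (Real.exp (2 * C) + 2 * C)) fun z => by
      rw [norm_mul]
      exact mul_le_mul_of_nonneg_right (hg z) (norm_nonneg _)
  have h1 := (hsum hu fun z => hbd (z + 1) z).hasSum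
  have h2 := (hsum hd fun z => hbd 0 z).hasSum
  have h3 := hasSum_edges (f := fun e => tau (α e.2 - α e.1) * lam e.1 e.2 ξ * mass ξ e.1)
    (h1.congr_fun fun z => by simp only [upFlux]; ring)
    (h2.congr_fun fun z => by
      simp only [downFlux]
      split_ifs <;> ring)
  have h4 := hasSum_sum_mul_divergence α p hq
  have h5 := hasSum_sum_mul_divergence α (upFlux lam ξ) hd
  unfold localFunctional
  rw [h3.tsum_eq]
  have h6 : (α.sum fun z a => a * (divergence p q z - drift lam ξ z)) =
      (α.sum fun z a => a * divergence p q z) -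
      α.sum fun z a => a * divergence (upFlux lam ξ) (downFlux lam ξ) z := by
    rw [drift_eq_divergence lam ξ hd, ← Finsupp.sum_sub]
    simp only [mul_sub]
  rw [h6]
  refine ((h4.sub h5).sub (h1.add h2)).congr_fun fun z => ?_
  unfold tau
  ring

/-- Legendre duality for the exponential: write `exp D = R * exp (D - log R)` and use `1 + x ≤ exp
x`. Only an upper bound `R` for the ratio `f / w` is needed. -/
theorem mul_le_mul_log_add_exp_mul {f R w : ℝ} (D : ℝ) (hf : 0 ≤ f) (hR : 0 < R)
    (h : f ≤ R * w) : D * f ≤ f * Real.log R + Real.exp D * w := by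
  have h1 : Real.exp D = R * Real.exp (D - Real.log R) := by
    rw [Real.exp_sub, Real.exp_log hR]
    field_simp
  have h2 := Real.add_one_le_exp (D - Real.log R)
  have h3 : f * Real.exp (D - Real.log R) ≤ R * w * Real.exp (D - Real.log R) :=
    mul_le_mul_of_nonneg_right h (Real.exp_pos _).le
  rw [h1]
  nlinarith

/-- A velocity that is the divergence of a flux has a local cost controlled by the relative size
of this flux and that of the mean-field dynamics. -/
theorem localCost_divergence_le {lam : ℕ → ℕ → PMF ℕ → ℝ} {ξ : PMF ℕ} {lo hi : ℝ} (hlo : 0 < lo)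
    (hup : ∀ z : ℕ, lo / (z + 1) ≤ lam z (z + 1) ξ ∧ lam z (z + 1) ξ ≤ hi / (z + 1))
    (hdown : ∀ z : ℕ, z ≠ 0 → lo ≤ lam z 0 ξ ∧ lam z 0 ξ ≤ hi)
    {p q R : ℕ → ℝ} {Q : ℝ} (hp : ∀ z, 0 ≤ p z) (hq : ∀ z, 0 ≤ q z) (hqs : Summable q)
    (hR : ∀ z, 1 ≤ R z) (hQ : 1 ≤ Q) (hpR : ∀ z, p z ≤ R z * upFlux lam ξ z)
    (hqQ : ∀ z, q z ≤ Q * downFlux lam ξ z) :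
    localCost lam ξ (divergence p q) ≤
      (∑' z, ENNReal.ofReal (p z * Real.log (R z))) + ENNReal.ofReal (Real.log Q * ∑' z, q z)
        + ENNReal.ofReal (2 * hi) := by
  obtain ⟨hu, hu'⟩ := summable_upFlux hlo hup
  obtain ⟨hd, hd'⟩ := summable_downFlux hlo hdown
  have hhi : 0 ≤ hi := by linarith [(hdown 1 one_ne_zero).1.trans (hdown 1 one_ne_zero).2]
  have hu0 : ∀ z, 0 ≤ upFlux lam ξ z := fun z =>
    mul_nonneg (le_trans (by positivity) (hup z).1) (mass_nonneg ξ z)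
  refine iSup_le fun α => ?_
  -- Beyond `N` the forward increments of `α` vanish, so only finitely many terms `p z * log (R z)`
  -- enter; their full sum may be infinite.
  obtain ⟨N, hN⟩ : ∃ N, ∀ z ≥ N, α z = 0 := by
    obtain ⟨N, hN⟩ := α.support.bddAbove
    refine ⟨N + 1, fun z hz => ?_⟩
    by_contra h
    have := hN (Finset.mem_coe.mpr (Finsupp.mem_support_iff.mpr h))
    omega
  have h1 := hasSum_localFunctional (p := p) hqs hu hd α
  have hX : HasSum (fun z => if z < N then p z * Real.log (R z) else 0)
      (∑ z ∈ Finset.range N, p z * Real.log (R z)) := by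
    rw [← Finset.sum_congr rfl fun z hz => if_pos (Finset.mem_range.mp hz)]
    exact hasSum_sum_of_ne_finset_zero fun z hz => if_neg (Finset.mem_range.not.mp hz)
  -- After the exponentials cancel, each edge leaves one copy of its natural flux; both totals are
  -- at most `hi`, which gives `2 * hi`.
  have h2 := hX.add ((hqs.hasSum.mul_left (Real.log Q)).add (hu.hasSum.add hd.hasSum))
  have h3 := hasSum_le (fun z => ?_) h1 h2
  · refine (ENNReal.ofReal_le_ofReal h3).trans ?_
    have hlogp : ∀ z, 0 ≤ p z * Real.log (R z) := fun z => mul_nonneg (hp z) (Real.log_nonneg (hR z))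
    have hqt : 0 ≤ Real.log Q * ∑' z, q z := mul_nonneg (Real.log_nonneg hQ) (tsum_nonneg hq)
    calc _ ≤ ENNReal.ofReal (∑ z ∈ Finset.range N, p z * Real.log (R z)) +
          (ENNReal.ofReal (Real.log Q * ∑' z, q z) +
            ENNReal.ofReal (∑' z, upFlux lam ξ z + ∑' z, downFlux lam ξ z)) :=
          ENNReal.ofReal_add_le.trans (add_le_add le_rfl ENNReal.ofReal_add_le)
      _ ≤ _ := by
        rw [add_assoc]
        gcongr
        · rw [ENNReal.ofReal_sum_of_nonneg fun z _ => hlogp z]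
          exact ENNReal.sum_le_tsum _
        · linarith
  · have e1 := mul_le_mul_log_add_exp_mul (α 0 - α z) (hq z) (zero_lt_one.trans_le hQ) (hqQ z)
    have e2 := mul_le_mul_log_add_exp_mul (α (z + 1) - α z) (hp z)
      (zero_lt_one.trans_le (hR z)) (hpR z)
    split_ifs with hz
    · linarith
    · rw [hN z (not_lt.mp hz), hN (z + 1) (by omega)] at e2 ⊢
      rw [hN z (not_lt.mp hz)] at e1
      simp only [sub_self, zero_mul, Real.exp_zero, sub_zero, zero_add]
      have := hu0 z
      simp only [sub_zero] at e1
      linarith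

/-! ### Concatenation of paths -/

/-- A monotone map keeps disjoint intervals disjoint, and a 1-Lipschitz one does not lengthen them.
-/
theorem _root_.AbsolutelyContinuousOnInterval.comp_monotone {f g : ℝ → ℝ} {a b c d : ℝ}
    (hf : AbsolutelyContinuousOnInterval f c d) (hg : Monotone g)
    (hmaps : ∀ x ∈ Set.uIcc a b, g x ∈ Set.uIcc c d) (hdist : ∀ x y, dist (g x) (g y) ≤ dist x y) :
    AbsolutelyContinuousOnInterval (fun x => f (g x)) a b := by
  rw [absolutelyContinuousOnInterval_iff] at hf ⊢
  intro ε hε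
  obtain ⟨δ, hδ, h⟩ := hf ε hε
  refine ⟨δ, hδ, fun E hE hlen => h (E.1, fun i => (g (E.2 i).1, g (E.2 i).2)) ⟨?_, ?_⟩ ?_⟩
  · exact fun i hi => ⟨hmaps _ (hE.1 i hi).1, hmaps _ (hE.1 i hi).2⟩
  · intro i hi j hj hij
    have hdisj : Disjoint (Set.uIoc (E.2 i).1 (E.2 i).2) (Set.uIoc (E.2 j).1 (E.2 j).2) :=
      hE.2 hi hj hij
    change Disjoint (Set.uIoc (g (E.2 i).1) (g (E.2 i).2)) (Set.uIoc (g (E.2 j).1) (g (E.2 j).2))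
    simp only [Set.uIoc, Set.Ioc_disjoint_Ioc] at hdisj ⊢
    rw [← hg.map_min, ← hg.map_min, ← hg.map_max, ← hg.map_max, ← hg.map_min, ← hg.map_max]
    exact hg hdisj
  · exact (Finset.sum_le_sum fun i _ => hdist _ _).trans_lt hlen

theorem _root_.AbsolutelyContinuousOnInterval.congr_uIcc {f g : ℝ → ℝ} {a b : ℝ}
    (hf : AbsolutelyContinuousOnInterval f a b) (h : ∀ x ∈ Set.uIcc a b, g x = f x) :
    AbsolutelyContinuousOnInterval g a b := by
  rw [absolutelyContinuousOnInterval_iff] at hf ⊢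
  intro ε hε
  obtain ⟨δ, hδ, hd⟩ := hf ε hε
  refine ⟨δ, hδ, fun E hE hlen => ?_⟩
  rw [Finset.sum_congr rfl fun i hi => by rw [h _ (hE.1 i hi).1, h _ (hE.1 i hi).2]]
  exact hd E hE hlen

/-- The glued function equals `f (min s S) + g (max s S - S) - g 0`, a combination of two monotone
reparametrizations. -/
theorem _root_.AbsolutelyContinuousOnInterval.concat {f g : ℝ → ℝ} {S T : ℝ} (hS : 0 ≤ S)
    (hT : 0 ≤ T) (hf : AbsolutelyContinuousOnInterval f 0 S)
    (hg : AbsolutelyContinuousOnInterval g 0 T) (hfg : f S = g 0) :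
    AbsolutelyContinuousOnInterval (fun s => if s ≤ S then f s else g (s - S)) 0 (S + T) := by
  have h1 : AbsolutelyContinuousOnInterval (fun s => f (min s S)) 0 (S + T) := by
    refine hf.comp_monotone (fun x y h => min_le_min_right S h) (fun x hx => ?_) fun x y => ?_
    · rw [Set.uIcc_of_le (by linarith)] at hx
      rw [Set.uIcc_of_le hS]
      exact ⟨le_min hx.1 hS, min_le_right _ _⟩
    · rw [Real.dist_eq, Real.dist_eq]
      exact (abs_min_sub_min_le_max x S y S).trans (by simp)
  have h2 : AbsolutelyContinuousOnInterval (fun s => g (max s S - S)) 0 (S + T) := by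
    refine hg.comp_monotone (fun x y h => sub_le_sub_right (max_le_max_right S h) S)
      (fun x hx => ?_) fun x y => ?_
    · rw [Set.uIcc_of_le (by linarith)] at hx
      rw [Set.uIcc_of_le hT]
      exact ⟨sub_nonneg.mpr (le_max_right _ _), by
        rw [sub_le_iff_le_add']
        exact max_le hx.2 (by linarith)⟩
    · rw [Real.dist_eq, Real.dist_eq, sub_sub_sub_cancel_right]
      exact abs_max_sub_max_le_abs x y S
  have h3 : AbsolutelyContinuousOnInterval (fun _ : ℝ => g 0) 0 (S + T) :=
    contDiffOn_const.absolutelyContinuousOnInterval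
  refine ((h1.add h2).sub h3).congr_uIcc fun x _ => ?_
  simp only [Pi.add_apply, Pi.sub_apply]
  split_ifs with h
  · rw [min_eq_left h, max_eq_right h, sub_self, add_sub_cancel_right]
  · rw [min_eq_right (not_le.mp h).le, max_eq_left (not_le.mp h).le, hfg, add_sub_cancel_left]

/-- Endpoints are null, so the derivative at a junction of two paths is irrelevant. -/
theorem lintegral_Icc_mono_of_Ioo {f g : ℝ → ℝ≥0∞} {S T : ℝ} (h : ∀ s ∈ Set.Ioo S T, f s ≤ g s) :
    ∫⁻ s in Set.Icc S T, f s ≤ ∫⁻ s in Set.Icc S T, g s := by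
  rw [← restrict_Ioo_eq_restrict_Icc]
  exact setLIntegral_mono' measurableSet_Ioo h

theorem lintegral_Icc_comp_sub (f : ℝ → ℝ≥0∞) (S T : ℝ) :
    ∫⁻ s in Set.Icc S (S + T), f (s - S) = ∫⁻ s in Set.Icc 0 T, f s := by
  rw [← lintegral_indicator measurableSet_Icc, ← lintegral_indicator measurableSet_Icc,
    ← lintegral_sub_right_eq_self ((Set.Icc 0 T).indicator f) S]
  congr 1
  ext s
  simp only [Set.indicator, Set.mem_Icc, sub_nonneg, sub_le_iff_le_add']

theorem exists_concat (lam : ℕ → ℕ → PMF ℕ → ℝ) {S T : ℝ} (hS : 0 ≤ S) (hT : 0 < T)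
    (φ ψ : ℝ → PMF ℕ) (h : φ S = ψ 0) :
    ∃ χ : ℝ → PMF ℕ, χ 0 = φ 0 ∧ χ (S + T) = ψ T ∧
      pathCost lam (S + T) χ (φ 0) ≤ pathCost lam S φ (φ 0) + pathCost lam T ψ (ψ 0) := by
  refine ⟨fun s => if s ≤ S then φ s else ψ (s - S), if_pos hS, ?_, ?_⟩
  · simp [hT]
  by_cases h1 : IsAbsCont S φ
  swap
  · simp [pathCost, h1]
  by_cases h2 : IsAbsCont T ψ
  swap
  · simp [pathCost, h2]
  have h3 : IsAbsCont (S + T) (fun s => if s ≤ S then φ s else ψ (s - S)) := fun z => by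
    have := AbsolutelyContinuousOnInterval.concat hS hT.le (h1 z) (h2 z) (by rw [h])
    simpa only [apply_ite (fun ξ => mass ξ z)] using this
  have h4 : (if (0 : ℝ) ≤ S then φ 0 else ψ (0 - S)) = φ 0 := if_pos hS
  unfold pathCost
  rw [if_pos ⟨h4, h3⟩, if_pos ⟨rfl, h1⟩, if_pos ⟨rfl, h2⟩,
    ← Set.Icc_union_Icc_eq_Icc hS (by linarith : S ≤ S + T)]
  refine (lintegral_union_le _ _ _).trans (add_le_add ?_ ?_)
  · refine lintegral_Icc_mono_of_Ioo fun s hs => ?_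
    beta_reduce
    rw [if_pos hs.2.le]
    refine le_of_eq (congrArg _ (funext fun z => Filter.EventuallyEq.deriv_eq ?_))
    filter_upwards [Iio_mem_nhds hs.2] with r hr
    rw [if_pos (le_of_lt hr)]
  · rw [← lintegral_Icc_comp_sub _ S T]
    refine lintegral_Icc_mono_of_Ioo fun s hs => ?_
    beta_reduce
    rw [if_neg (not_le.mpr hs.1)]
    refine le_of_eq (congrArg _ (funext fun z => ?_))
    rw [← deriv_comp_sub_const]
    refine Filter.EventuallyEq.deriv_eq ?_
    filter_upwards [Ioi_mem_nhds hs.1] with r hr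
    rw [if_neg (not_le.mpr hr)]

/-! ### Paths with prescribed masses, and time integrals -/

/-- The probability measure with masses `f`. -/
noncomputable def pmfOfMass (f : ℕ → ℝ) (h : (∀ z, 0 ≤ f z) ∧ HasSum f 1) : PMF ℕ :=
  ⟨fun z => ENNReal.ofReal (f z), by
    have := ENNReal.ofReal_tsum_of_nonneg h.1 h.2.summable
    rw [h.2.tsum_eq, ENNReal.ofReal_one] at this
    exact this ▸ ENNReal.summable.hasSum⟩

open Classical in
/-- The probability measure with masses `f`, if `f` is nonnegative with sum one, and a point mass
otherwise. -/
noncomputable def ofMass (f : ℕ → ℝ) : PMF ℕ :=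
  if h : (∀ z, 0 ≤ f z) ∧ HasSum f 1 then pmfOfMass f h
  else PMF.pure 0

theorem mass_ofMass {f : ℕ → ℝ} (h0 : ∀ z, 0 ≤ f z) (h1 : HasSum f 1) (z : ℕ) :
    mass (ofMass f) z = f z := by
  unfold ofMass mass
  rw [dif_pos ⟨h0, h1⟩]
  exact ENNReal.toReal_ofReal (h0 z)

theorem ext_mass {ξ ζ : PMF ℕ} (h : ∀ z, mass ξ z = mass ζ z) : ξ = ζ := by
  ext z
  rw [← ofReal_mass, ← ofReal_mass, h]

/-- A path with prescribed continuously differentiable masses whose velocity is the divergence of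
a flux. -/
theorem pathCost_ofMass_le {lam : ℕ → ℕ → PMF ℕ → ℝ} {t : ℝ} (ht : 0 < t) {F : ℝ → ℕ → ℝ}
    {v : ℝ → ℕ → ℝ} {c : ℝ → ℝ≥0∞} (hF0 : ∀ s ∈ Set.Icc 0 t, ∀ z, 0 ≤ F s z)
    (hF1 : ∀ s ∈ Set.Icc 0 t, HasSum (F s) 1) (hF : ∀ z, ContDiff ℝ 1 fun s => F s z)
    (hv : ∀ s ∈ Set.Ioo 0 t, ∀ z, HasDerivAt (fun r => F r z) (v s z) s)
    (hc : ∀ s ∈ Set.Ioo 0 t, localCost lam (ofMass (F s)) (v s) ≤ c s) :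
    pathCost lam t (fun s => ofMass (F s)) (ofMass (F 0)) ≤ ∫⁻ s in Set.Icc 0 t, c s := by
  have hm : ∀ s ∈ Set.Icc 0 t, ∀ z, mass (ofMass (F s)) z = F s z := fun s hs =>
    mass_ofMass (hF0 s hs) (hF1 s hs)
  have hac : IsAbsCont t fun s => ofMass (F s) := fun z =>
    (hF z).contDiffOn.absolutelyContinuousOnInterval.congr_uIcc fun s hs =>
      hm s (Set.uIcc_of_le ht.le ▸ hs) z
  unfold pathCost
  rw [if_pos ⟨rfl, hac⟩]
  refine lintegral_Icc_mono_of_Ioo fun s hs => ?_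
  have : (fun z => deriv (fun r => mass (ofMass (F r)) z) s) = v s := by
    ext z
    refine HasDerivAt.deriv ((hv s hs z).congr_of_eventuallyEq ?_)
    filter_upwards [Icc_mem_nhds hs.1 hs.2] with r hr
    exact hm r hr z
  rw [this]
  exact hc s hs

/-- Differentiability is asked only inside the interval, to allow the square root singularity at
`t`; nonnegativity of the derivative supplies integrability. -/
theorem lintegral_ofReal_deriv {g g' : ℝ → ℝ} {t : ℝ} (ht : 0 ≤ t)
    (hcont : ContinuousOn g (Set.Icc 0 t)) (hderiv : ∀ s ∈ Set.Ioo 0 t, HasDerivAt g (g' s) s)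
    (hpos : ∀ s ∈ Set.Ioo 0 t, 0 ≤ g' s) :
    ∫⁻ s in Set.Icc 0 t, ENNReal.ofReal (g' s) = ENNReal.ofReal (g t - g 0) := by
  have hint := intervalIntegral.integrableOn_deriv_of_nonneg hcont hderiv hpos
  have h1 := intervalIntegral.integral_eq_sub_of_hasDerivAt_of_le ht hcont hderiv
    ((intervalIntegrable_iff_integrableOn_Ioc_of_le ht).mpr hint)
  rw [intervalIntegral.integral_of_le ht, integral_Ioc_eq_integral_Ioo] at h1
  rw [← h1, ← restrict_Ioo_eq_restrict_Icc, ofReal_integral_eq_lintegral_ofReal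
    (hint.mono_set Set.Ioo_subset_Ioc_self)]
  exact (ae_restrict_mem measurableSet_Ioo).mono hpos

theorem lintegral_ofReal_pow {t : ℝ} (ht : 0 < t) (z : ℕ) :
    ∫⁻ s in Set.Icc 0 t, ENNReal.ofReal ((z + 1) * (s / t) ^ z / t) = 1 := by
  rw [lintegral_ofReal_deriv (g := fun s => (s / t) ^ (z + 1)) ht.le]
  · simp [div_self ht.ne']
  · fun_prop
  · intro s _
    refine (((hasDerivAt_id s).div_const t).pow (z + 1)).congr_deriv ?_
    simp
    ring
  · intro s hs
    have := hs.1.le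
    positivity

theorem lintegral_ofReal_inv_sqrt {t : ℝ} (ht : 0 < t) :
    ∫⁻ s in Set.Icc 0 t, ENNReal.ofReal (1 / √(1 - s / t) / t) = 2 := by
  rw [lintegral_ofReal_deriv (g := fun s => -2 * √(1 - s / t)) ht.le]
  · simp [div_self ht.ne']
  · fun_prop
  · intro s hs
    have h1 : 0 < 1 - s / t := sub_pos.mpr ((div_lt_one ht).mpr hs.2)
    have h2 : HasDerivAt (fun s => 1 - s / t) (-(1 / t)) s := by
      simpa using ((hasDerivAt_id s).div_const t).const_sub 1
    refine ((h2.sqrt h1.ne').const_mul (-2)).congr_deriv ?_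
    field_simp
  · intro s hs
    positivity

/-- Trades the logarithmic singularity of the cost as `s → t` for an inverse square root with an
explicit integral. -/
theorem log_le_two_mul_sqrt {x : ℝ} (hx : 0 < x) : Real.log x ≤ 2 * √x := by
  have h1 := Real.log_le_sub_one_of_pos (Real.sqrt_pos.mpr hx)
  rw [Real.log_sqrt hx.le] at h1
  linarith

theorem theta_nonneg (z : ℕ) : 0 ≤ theta z :=
  mul_nonneg z.cast_nonneg (Real.log_natCast_nonneg z)

theorem le_one_add_theta (z : ℕ) : (z : ℝ) ≤ 1 + theta z := by
  rcases Nat.eq_zero_or_pos z with rfl | hz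
  · simp [theta]
  · have hz' : (0 : ℝ) < z := Nat.cast_pos.mpr hz
    have h1 := mul_le_mul_of_nonneg_left (Real.one_sub_inv_le_log_of_pos hz') hz'.le
    rw [mul_sub, mul_inv_cancel₀ hz'.ne'] at h1
    unfold theta
    linarith

/-! ### Moving the surplus to the point 0 -/

/-- Moving the mass `a` of a measure `m + a` to the point `0` with constant speed. -/
noncomputable def collapse (m a : ℕ → ℝ) (t s : ℝ) (z : ℕ) : ℝ :=
  m z + (1 - s / t) * a z + if z = 0 then s / t * ∑' y, a y else 0

section Rates

variable {lam : ℕ → ℕ → PMF ℕ → ℝ} {lo hi : ℝ}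

/-- The required flux from `z ≠ 0` is `a z / t`, the natural one at least `lo * (1 - s / t) * a z`.
The logarithm of the ratio `1 / (t * lo * (1 - s / t))` is integrable in time, and `htlo` makes the
ratio at least `1`. -/
theorem pathCost_collapse_le (hlo : 0 < lo) (hb : ∀ ξ : PMF ℕ,
      (∀ z : ℕ, lo / (z + 1) ≤ lam z (z + 1) ξ ∧ lam z (z + 1) ξ ≤ hi / (z + 1)) ∧
      (∀ z : ℕ, z ≠ 0 → lo ≤ lam z 0 ξ ∧ lam z 0 ξ ≤ hi))
    {m a : ℕ → ℝ} (hm : ∀ z, 0 ≤ m z) (ha : ∀ z, 0 ≤ a z) (hms : Summable m) (has : Summable a)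
    (hma : ∑' z, m z + ∑' z, a z = 1) {t : ℝ} (ht : 0 < t) (htlo : t * lo ≤ 1) :
    pathCost lam t (fun s => ofMass (collapse m a t s)) (ofMass (collapse m a t 0)) ≤
      ENNReal.ofReal (4 / √(t * lo)) * ENNReal.ofReal (∑' z, a z) + ENNReal.ofReal (2 * hi * t) := by
  have hA : 0 ≤ ∑' z, a z := tsum_nonneg ha
  have hu : ∀ s ∈ Set.Icc 0 t, 0 ≤ s / t ∧ 0 ≤ 1 - s / t := fun s hs =>
    ⟨div_nonneg hs.1 ht.le, sub_nonneg.mpr ((div_le_one ht).mpr hs.2)⟩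
  have h0 : ∀ s ∈ Set.Icc 0 t, ∀ z, 0 ≤ collapse m a t s z := fun s hs z => by
    obtain ⟨h1, h2⟩ := hu s hs
    have := hm z
    have := ha z
    unfold collapse
    split_ifs <;> positivity
  have h1 : ∀ s ∈ Set.Icc 0 t, HasSum (collapse m a t s) 1 := fun s _ => by
    have := (hms.hasSum.add (has.hasSum.mul_left (1 - s / t))).add
      (hasSum_ite_eq 0 (s / t * ∑' z, a z))
    rwa [show ∑' z, m z + (1 - s / t) * ∑' z, a z + s / t * ∑' z, a z = 1 from
      Eq.trans (by ring) hma] at this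
  -- The mass `a 0` is already at `0` and needs no flux.
  refine (pathCost_ofMass_le (v := fun _ => divergence 0 fun z => if z = 0 then 0 else a z / t)
    (c := fun s => ENNReal.ofReal (2 / √(t * lo) * ∑' z, a z) *
      ENNReal.ofReal (1 / √(1 - s / t) / t) + ENNReal.ofReal (2 * hi)) ht h0 h1 ?_ ?_ ?_).trans ?_
  · intro z
    unfold collapse
    split_ifs <;> fun_prop
  · intro s _ z
    have hd : HasDerivAt (fun s => s / t) (1 / t) s := (hasDerivAt_id s).div_const t
    have h2 : HasDerivAt (fun s => m z + (1 - s / t) * a z) (-(a z / t)) s := by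
      refine (((hd.const_sub 1).mul_const (a z)).const_add (m z)).congr_deriv ?_
      ring
    have h3 := (hasSum_ite_sub_hasSum (has.hasSum.div_const t) 0).tsum_eq
    unfold collapse divergence
    by_cases hz : z = 0
    · subst hz
      simp only [if_true, h3]
      refine (h2.add (hd.mul_const (∑' y, a y))).congr_deriv ?_
      simp only [Pi.zero_apply]
      ring
    · simp only [hz, if_false, add_zero]
      refine h2.congr_deriv ?_
      simp
  · intro s hs
    have hs' := Set.Ioo_subset_Icc_self hs
    obtain ⟨hu0, -⟩ := hu s hs'
    have hu1 : 0 < 1 - s / t := sub_pos.mpr ((div_lt_one ht).mpr hs.2)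
    have h3 := hasSum_ite_sub_hasSum (has.hasSum.div_const t) 0
    have hQ0 : 0 < t * lo * (1 - s / t) := by positivity
    have hQ1 : 1 ≤ 1 / (t * lo * (1 - s / t)) := by
      rw [le_div_iff₀ hQ0]
      nlinarith
    have hq0 : ∀ z, 0 ≤ if z = 0 then 0 else a z / t := fun z => by
      have := ha z
      split_ifs <;> positivity
    refine (localCost_divergence_le hlo (hb _).1 (hb _).2 (p := 0) (R := 1)
      (Q := 1 / (t * lo * (1 - s / t))) (fun _ => le_rfl) hq0 h3.summable (fun _ => le_rfl)
      hQ1 (fun z => ?_) fun z => ?_).trans ?_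
    · have := le_trans (by positivity) ((hb (ofMass (collapse m a t s))).1 z).1
      exact mul_nonneg zero_le_one (mul_nonneg this (mass_nonneg _ z))
    · by_cases hz : z = 0
      · simp [downFlux, hz]
      · have h4 : (1 - s / t) * a z ≤ collapse m a t s z := by
          unfold collapse
          rw [if_neg hz]
          linarith [hm z]
        have h5 := ((hb (ofMass (collapse m a t s))).2 z hz).1
        simp only [downFlux, hz, if_false, mass_ofMass (h0 s hs') (h1 s hs')]
        calc a z / t = 1 / (t * lo * (1 - s / t)) * (lo * ((1 - s / t) * a z)) := by
              have := hu1.ne'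
              generalize 1 - s / t = r at *
              field_simp
          _ ≤ _ := mul_le_mul_of_nonneg_left (mul_le_mul h5 h4 (mul_nonneg hu1.le (ha z))
              (hlo.le.trans h5)) (by positivity)
    · gcongr
      simp only [Pi.zero_apply, zero_mul, ENNReal.ofReal_zero, tsum_zero, zero_add]
      rw [← ENNReal.ofReal_mul (by positivity)]
      refine ENNReal.ofReal_le_ofReal ?_
      rw [h3.tsum_eq]
      have h4 := log_le_two_mul_sqrt (zero_lt_one.trans_le hQ1)
      rw [Real.sqrt_div zero_le_one, Real.sqrt_one, Real.sqrt_mul (by positivity)] at h4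
      have h5 : (∑' z, a z) / t - a 0 / t ≤ (∑' z, a z) / t :=
        sub_le_self _ (div_nonneg (ha 0) ht.le)
      calc _ ≤ Real.log (1 / (t * lo * (1 - s / t))) * ((∑' z, a z) / t) :=
            mul_le_mul_of_nonneg_left h5 (Real.log_nonneg hQ1)
        _ ≤ 2 * (1 / (√(t * lo) * √(1 - s / t))) * ((∑' z, a z) / t) := by gcongr
        _ = _ := by field_simp
  · rw [lintegral_add_right _ measurable_const, lintegral_const_mul' _ _ ENNReal.ofReal_ne_top,
      lintegral_ofReal_inv_sqrt ht, lintegral_const, Measure.restrict_apply_univ, Real.volume_Icc,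
      sub_zero]
    refine le_of_eq (congrArg₂ _ ?_ (ENNReal.ofReal_mul' ht.le).symm)
    rw [← ENNReal.ofReal_mul (by positivity), ← ENNReal.ofReal_ofNat 2,
      ← ENNReal.ofReal_mul (by positivity)]
    congr 1
    ring

/-! ### Building up mass from the point 0 -/

/-- The mass of `[z, ∞)`. -/
noncomputable def tail (b : ℕ → ℝ) (z : ℕ) : ℝ := ∑' y, b (y + z)

theorem tail_nonneg {b : ℕ → ℝ} (hb : ∀ z, 0 ≤ b z) (z : ℕ) : 0 ≤ tail b z :=
  tsum_nonneg fun _ => hb _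

theorem tail_eq_add {b : ℕ → ℝ} (hb : Summable b) (z : ℕ) : tail b z = b z + tail b (z + 1) := by
  unfold tail
  rw [((summable_nat_add_iff z).mpr hb).tsum_eq_zero_add, zero_add]
  simp only [add_right_comm, add_assoc]

/-- Building up the mass `b` from mass at the point `0`: at time `s` the moving mass of `[z, ∞)`
is `(s / t) ^ z` times its final value. -/
noncomputable def spread (m b : ℕ → ℝ) (t s : ℝ) (z : ℕ) : ℝ :=
  m z + (tail b z * (s / t) ^ z - tail b (z + 1) * (s / t) ^ (z + 1))

/-- `tail b (z + 1) ≤ tail b z`. The lower bound carries the same factor `tail b (z + 1) * (s / t) ^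
z` as the flux from `z` to `z + 1`, so `b` drops out of the flux ratio. -/
theorem le_spread {m b : ℕ → ℝ} (hb : ∀ z, 0 ≤ b z) (hbs : Summable b) {t s : ℝ}
    (hu : 0 ≤ s / t) (z : ℕ) :
    m z + tail b (z + 1) * (s / t) ^ z * (1 - s / t) ≤ spread m b t s z := by
  unfold spread
  rw [tail_eq_add hbs z, pow_succ]
  have := mul_nonneg (hb z) (pow_nonneg hu z)
  nlinarith

theorem hasSum_spread {m b : ℕ → ℝ} (hb : ∀ z, 0 ≤ b z) (hms : Summable m) (hbs : Summable b)
    {t s : ℝ} (hu : 0 ≤ s / t) (hu' : 0 ≤ 1 - s / t) :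
    HasSum (spread m b t s) (∑' z, m z + ∑' z, b z) := by
  refine hms.hasSum.add ?_
  rw [hasSum_iff_tendsto_nat_of_nonneg]
  · have h0 : tail b 0 * (s / t) ^ 0 = ∑' z, b z := by simp [tail]
    simp only [Finset.sum_range_sub' (fun z => tail b z * (s / t) ^ z), h0]
    have h1 : Tendsto (tail b) atTop (𝓝 0) := tendsto_sum_nat_add b
    have h2 : Tendsto (fun n => tail b n * (s / t) ^ n) atTop (𝓝 0) :=
      squeeze_zero (fun n => mul_nonneg (tail_nonneg hb n) (pow_nonneg hu n))
        (fun n => mul_le_of_le_one_right (tail_nonneg hb n) (pow_le_one₀ hu (by linarith))) h1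
    simpa using h2.const_sub (∑' z, b z)
  · intro z
    have h1 := le_spread (m := 0) hb hbs hu z
    simp only [spread, Pi.zero_apply, zero_add] at h1
    exact le_trans (mul_nonneg (mul_nonneg (tail_nonneg hb _) (pow_nonneg hu _)) hu') h1

/-- Spending an extra `2 * log (z + 1)` puts a factor `1 / (z + 1)` in front of the singular term;
it cancels the factor `z + 1` of the flux. -/
theorem log_spread_ratio_le {u κ : ℝ} (hu : 0 < 1 - u) (hκ : 0 < κ) (z : ℕ) :
    Real.log ((z + 1) ^ 2 / (κ * (1 - u))) ≤
      4 * Real.log (z + 1) - Real.log κ + 2 / ((z + 1) * √(1 - u)) := by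
  have hz : (0 : ℝ) < z + 1 := by positivity
  have hs := Real.sqrt_pos.mpr hu
  have h1 := Real.log_le_sub_one_of_pos (show 0 < 1 / ((z + 1) * √(1 - u)) by positivity)
  rw [Real.log_div one_ne_zero (by positivity), Real.log_one, Real.log_mul hz.ne' hs.ne',
    Real.log_sqrt hu.le] at h1
  rw [Real.log_div (by positivity) (by positivity), Real.log_mul hκ.ne' hu.ne', Real.log_pow,
    show 2 / ((z + 1) * √(1 - u)) = 2 * (1 / ((z + 1) * √(1 - u))) by ring]
  push_cast
  linarith

/-- Exchanging sums, `b n` is charged with all levels `z < n`, that is with at most `n * (4 * log n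
+ K)`. -/
theorem tsum_tail_mul_le {b : ℕ → ℝ} (hb : ∀ z, 0 ≤ b z) (hbs : Summable b) {K : ℝ} (hK : 0 ≤ K) :
    ∑' z, ENNReal.ofReal (tail b (z + 1) * (4 * Real.log (z + 1) + K)) ≤
      ENNReal.ofReal (4 + K) * ∑' z, ENNReal.ofReal (b z * (1 + theta z)) := by
  have hk : ∀ z : ℕ, 0 ≤ 4 * Real.log (z + 1) + K := fun z => by
    have : 0 ≤ Real.log ((z : ℝ) + 1) := Real.log_nonneg (by linarith [z.cast_nonneg (α := ℝ)])
    positivity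
  have h1 : ∀ z : ℕ, ENNReal.ofReal (tail b (z + 1) * (4 * Real.log (z + 1) + K)) =
      ∑' n, if z < n then ENNReal.ofReal (b n) * ENNReal.ofReal (4 * Real.log (z + 1) + K)
        else 0 := fun z => by
    rw [ENNReal.ofReal_mul (tail_nonneg hb _), tail, ENNReal.ofReal_tsum_of_nonneg (fun _ => hb _)
      ((summable_nat_add_iff (z + 1)).mpr hbs), ← ENNReal.tsum_mul_right,
      ← (add_left_injective (z + 1)).tsum_eq (f := fun n => if z < n then
        ENNReal.ofReal (b n) * ENNReal.ofReal (4 * Real.log (z + 1) + K) else 0)]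
    · refine tsum_congr fun y => ?_
      rw [if_pos (by omega)]
    · intro n hn
      by_contra h
      refine hn (if_neg fun h' => h ⟨n - (z + 1), ?_⟩)
      exact Nat.sub_add_cancel h'
  simp only [h1]
  rw [ENNReal.tsum_comm, ← ENNReal.tsum_mul_left]
  refine ENNReal.tsum_le_tsum fun n => ?_
  rw [tsum_eq_sum (s := Finset.range n) fun z hz => if_neg (Finset.mem_range.not.mp hz),
    Finset.sum_congr rfl fun z hz => if_pos (Finset.mem_range.mp hz), ← Finset.mul_sum,
    ← ENNReal.ofReal_sum_of_nonneg fun z _ => hk z, ← ENNReal.ofReal_mul (hb n),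
    ← ENNReal.ofReal_mul (by positivity)]
  refine ENNReal.ofReal_le_ofReal ?_
  have h2 : ∑ z ∈ Finset.range n, (4 * Real.log ((z : ℝ) + 1) + K) ≤ n * (4 * Real.log n + K) := by
    have := Finset.sum_le_card_nsmul (Finset.range n) (fun z => 4 * Real.log ((z : ℝ) + 1) + K)
      (4 * Real.log n + K) fun z hz => ?_
    · rwa [nsmul_eq_mul, Finset.card_range] at this
    have : (z : ℝ) + 1 ≤ n := by exact_mod_cast Finset.mem_range.mp hz
    gcongr
  have h3 : n * (4 * Real.log n + K) ≤ (4 + K) * (1 + theta n) := by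
    have := mul_le_mul_of_nonneg_left (le_one_add_theta n) hK
    have : n * (4 * Real.log n + K) = 4 * theta n + K * n := by unfold theta; ring
    linarith
  calc _ ≤ b n * ((4 + K) * (1 + theta n)) := mul_le_mul_of_nonneg_left (h2.trans h3) (hb n)
    _ = _ := by ring

/-- The flux across `(z, z + 1)` is the time derivative of `tail b (z + 1) * (s / t) ^ (z + 1)`.
Compared with the natural flux, by `le_spread`, its ratio is at most `(z + 1) ^ 2 / (t * lo * (1 - s
/ t))`. -/
theorem pathCost_spread_le (hlo : 0 < lo) (hb : ∀ ξ : PMF ℕ,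
      (∀ z : ℕ, lo / (z + 1) ≤ lam z (z + 1) ξ ∧ lam z (z + 1) ξ ≤ hi / (z + 1)) ∧
      (∀ z : ℕ, z ≠ 0 → lo ≤ lam z 0 ξ ∧ lam z 0 ξ ≤ hi))
    {m b : ℕ → ℝ} (hm : ∀ z, 0 ≤ m z) (hb0 : ∀ z, 0 ≤ b z) (hms : Summable m) (hbs : Summable b)
    (hmb : ∑' z, m z + ∑' z, b z = 1) {t : ℝ} (ht : 0 < t) (htlo : t * lo ≤ 1) :
    pathCost lam t (fun s => ofMass (spread m b t s)) (ofMass (spread m b t 0)) ≤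
      ENNReal.ofReal (8 - Real.log (t * lo)) * (∑' z, ENNReal.ofReal (b z * (1 + theta z))) +
        ENNReal.ofReal (2 * hi * t) := by
  have hu : ∀ s ∈ Set.Icc 0 t, 0 ≤ s / t ∧ 0 ≤ 1 - s / t := fun s hs =>
    ⟨div_nonneg hs.1 ht.le, sub_nonneg.mpr ((div_le_one ht).mpr hs.2)⟩
  have hG := tail_nonneg hb0
  have h0' : ∀ s ∈ Set.Icc 0 t, ∀ z,
      tail b (z + 1) * (s / t) ^ z * (1 - s / t) ≤ spread m b t s z := fun s hs z => by
    linarith [le_spread (m := m) hb0 hbs (hu s hs).1 z, hm z]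
  have h0 : ∀ s ∈ Set.Icc 0 t, ∀ z, 0 ≤ spread m b t s z := fun s hs z =>
    le_trans (mul_nonneg (mul_nonneg (hG _) (pow_nonneg (hu s hs).1 _)) (hu s hs).2) (h0' s hs z)
  have h1 : ∀ s ∈ Set.Icc 0 t, HasSum (spread m b t s) 1 := fun s hs =>
    hmb ▸ hasSum_spread hb0 hms hbs (hu s hs).1 (hu s hs).2
  have hL : Real.log (t * lo) ≤ 0 := Real.log_nonpos (by positivity) htlo
  have hlog : ∀ z : ℕ, 0 ≤ Real.log ((z : ℝ) + 1) := fun z =>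
    Real.log_nonneg (by linarith [z.cast_nonneg (α := ℝ)])
  refine (pathCost_ofMass_le
    (v := fun s => divergence (fun z => tail b (z + 1) * ((z + 1) * (s / t) ^ z / t)) 0)
    (c := fun s => (∑' z : ℕ,
      (ENNReal.ofReal (tail b (z + 1) * (4 * Real.log (z + 1) - Real.log (t * lo))) *
        ENNReal.ofReal ((z + 1) * (s / t) ^ z / t) +
      ENNReal.ofReal (tail b (z + 1) * 2) * ENNReal.ofReal (1 / √(1 - s / t) / t))) +
      ENNReal.ofReal (2 * hi)) ht h0 h1 ?_ ?_ ?_).trans ?_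
  · intro z
    unfold spread
    fun_prop
  · intro s _ z
    have hd : ∀ n : ℕ, HasDerivAt (fun s => tail b n * (s / t) ^ n)
        (tail b n * (n * (s / t) ^ (n - 1) * (1 / t))) s := fun n =>
      (((hasDerivAt_id s).div_const t).pow n).const_mul (tail b n)
    refine (((hd z).sub (hd (z + 1))).const_add (m z)).congr_deriv ?_
    unfold divergence
    rcases z with _ | w
    · simp
    · simp
      ring
  · intro s hs
    have hs' := Set.Ioo_subset_Icc_self hs
    obtain ⟨hu0, -⟩ := hu s hs'
    have hu1 : 0 < 1 - s / t := sub_pos.mpr ((div_lt_one ht).mpr hs.2)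
    have hp0 : ∀ z : ℕ, 0 ≤ tail b (z + 1) * ((z + 1) * (s / t) ^ z / t) := fun z => by
      have := hG (z + 1)
      positivity
    have hd0 : 0 < t * lo * (1 - s / t) := by positivity
    refine (localCost_divergence_le hlo (hb _).1 (hb _).2 (q := 0)
      (R := fun z => (z + 1) ^ 2 / (t * lo * (1 - s / t))) (Q := 1) hp0 (fun _ => le_rfl)
      summable_zero (fun z => ?_) le_rfl (fun z => ?_) fun z => ?_).trans ?_
    · rw [le_div_iff₀ hd0]
      have : (0 : ℝ) ≤ z := z.cast_nonneg
      nlinarith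
    · have h5 := ((hb (ofMass (spread m b t s))).1 z).1
      simp only [upFlux, mass_ofMass (h0 s hs') (h1 s hs')]
      have h6 : 0 ≤ tail b (z + 1) * (s / t) ^ z * (1 - s / t) :=
        mul_nonneg (mul_nonneg (hG _) (pow_nonneg hu0 _)) hu1.le
      calc tail b (z + 1) * ((z + 1) * (s / t) ^ z / t) = (z + 1) ^ 2 / (t * lo * (1 - s / t)) *
            (lo / (z + 1) * (tail b (z + 1) * (s / t) ^ z * (1 - s / t))) := by
            have := hu1.ne'
            generalize 1 - s / t = r at *
            field_simp
        _ ≤ _ := mul_le_mul_of_nonneg_left (mul_le_mul h5 (h0' s hs' z) h6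
            (le_trans (by positivity) h5)) (by positivity)
    · have : 0 ≤ downFlux lam (ofMass (spread m b t s)) z := by
        unfold downFlux
        split_ifs with hz
        · rfl
        · exact mul_nonneg (hlo.le.trans ((hb _).2 z hz).1) (mass_nonneg _ z)
      simpa using this
    · gcongr
      simp only [Real.log_one, zero_mul, ENNReal.ofReal_zero, add_zero]
      refine ENNReal.tsum_le_tsum fun z => ?_
      have hg := hG (z + 1)
      have hl := hlog z
      rw [← ENNReal.ofReal_mul (mul_nonneg hg (by linarith)), ← ENNReal.ofReal_mul (by positivity),
        ← ENNReal.ofReal_add (mul_nonneg (mul_nonneg hg (by linarith)) (by positivity))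
          (by positivity)]
      refine ENNReal.ofReal_le_ofReal ?_
      have h4 := mul_le_mul_of_nonneg_left
        (log_spread_ratio_le hu1 (show 0 < t * lo by positivity) z) (hp0 z)
      refine h4.trans ?_
      have h5 : (s / t) ^ z ≤ 1 := pow_le_one₀ hu0 (by linarith)
      have h6 : tail b (z + 1) * ((z + 1) * (s / t) ^ z / t) * (2 / ((z + 1) * √(1 - s / t))) =
          (s / t) ^ z * (tail b (z + 1) * 2 * (1 / √(1 - s / t) / t)) := by
        have := Real.sqrt_pos.mpr hu1
        field_simp
      rw [mul_add, h6]
      refine add_le_add (le_of_eq (by ring)) (mul_le_of_le_one_left (by positivity) h5)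
  · rw [lintegral_add_right _ measurable_const, lintegral_tsum fun z => by fun_prop,
      lintegral_const, Measure.restrict_apply_univ, Real.volume_Icc, sub_zero,
      ← ENNReal.ofReal_mul' ht.le]
    gcongr
    -- The `4` in `K` is the coefficient `2` of the singular term times its time integral `2`.
    have h2 := tsum_tail_mul_le hb0 hbs (K := 4 - Real.log (t * lo)) (by linarith)
    rw [show 4 + (4 - Real.log (t * lo)) = 8 - Real.log (t * lo) by ring] at h2
    refine le_trans (le_of_eq (tsum_congr fun z => ?_)) h2
    have hg := hG (z + 1)
    have hl := hlog z
    rw [lintegral_add_left (by fun_prop), lintegral_const_mul' _ _ ENNReal.ofReal_ne_top,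
      lintegral_const_mul' _ _ ENNReal.ofReal_ne_top, lintegral_ofReal_inv_sqrt ht,
      lintegral_ofReal_pow ht, mul_one, ← ENNReal.ofReal_ofNat 2, ← ENNReal.ofReal_mul (by positivity),
      ← ENNReal.ofReal_add (mul_nonneg hg (by linarith)) (by positivity)]
    congr 1
    ring

/-! ### Connecting two measures -/

/-- The part of `ζ` that exceeds `ξ`, weighted with `1 + ϑ`. -/
noncomputable def excess (ξ ζ : PMF ℕ) : ℝ≥0∞ :=
  ∑' z, ENNReal.ofReal ((mass ζ z - min (mass ξ z) (mass ζ z)) * (1 + theta z))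

/-- The intermediate measure is the common part plus all remaining mass at `0`. Only the excess of
`ζ` is weighted by `theta`, since moving down to `0` is cheap from every height. -/
theorem exists_path_pathCost_le (hlo : 0 < lo) (hb : ∀ ξ : PMF ℕ,
      (∀ z : ℕ, lo / (z + 1) ≤ lam z (z + 1) ξ ∧ lam z (z + 1) ξ ≤ hi / (z + 1)) ∧
      (∀ z : ℕ, z ≠ 0 → lo ≤ lam z 0 ξ ∧ lam z 0 ξ ≤ hi))
    {t : ℝ} (ht : 0 < t) (htlo : t * lo ≤ 1) (ξ ζ : PMF ℕ) :
    ∃ φ : ℝ → PMF ℕ, φ 0 = ξ ∧ φ (t + t) = ζ ∧ pathCost lam (t + t) φ ξ ≤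
      (ENNReal.ofReal (4 / √(t * lo)) + ENNReal.ofReal (8 - Real.log (t * lo))) * excess ξ ζ +
        ENNReal.ofReal (4 * hi * t) := by
  set m : ℕ → ℝ := fun z => min (mass ξ z) (mass ζ z) with hmdef
  set a : ℕ → ℝ := fun z => mass ξ z - m z with hadef
  set b : ℕ → ℝ := fun z => mass ζ z - m z with hbdef
  have hm0 : ∀ z, 0 ≤ m z := fun z => le_min (mass_nonneg ξ z) (mass_nonneg ζ z)
  have ha0 : ∀ z, 0 ≤ a z := fun z => sub_nonneg.mpr (min_le_left _ _)
  have hb0 : ∀ z, 0 ≤ b z := fun z => sub_nonneg.mpr (min_le_right _ _)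
  have hms : Summable m := (summable_mass ξ).of_nonneg_of_le hm0 fun z => min_le_left _ _
  have has : HasSum a (1 - ∑' z, m z) := (hasSum_mass ξ).sub hms.hasSum
  have hbs : HasSum b (1 - ∑' z, m z) := (hasSum_mass ζ).sub hms.hasSum
  have hma : ∑' z, m z + ∑' z, a z = 1 := by rw [has.tsum_eq]; ring
  have hmb : ∑' z, m z + ∑' z, b z = 1 := by rw [hbs.tsum_eq]; ring
  have hξ : ofMass (collapse m a t 0) = ξ := by
    have : collapse m a t 0 = mass ξ := by
      ext z
      simp [collapse, hadef]
    rw [this]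
    exact ext_mass (mass_ofMass (mass_nonneg ξ) (hasSum_mass ξ))
  have hmid : collapse m a t t = spread m b t 0 := by
    ext z
    rcases z with _ | w
    · simp [collapse, spread, tail, ht.ne', has.tsum_eq, hbs.tsum_eq]
    · simp [collapse, spread, ht.ne']
  have hζ : ofMass (spread m b t t) = ζ := by
    have : spread m b t t = mass ζ := by
      ext z
      simp only [spread, div_self ht.ne', one_pow, mul_one, tail_eq_add hbs.summable z]
      simp [hbdef]
    rw [this]
    exact ext_mass (mass_ofMass (mass_nonneg ζ) (hasSum_mass ζ))
  have h1 := pathCost_collapse_le hlo hb hm0 ha0 hms has.summable hma ht htlo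
  have h2 := pathCost_spread_le hlo hb hm0 hb0 hms hbs.summable hmb ht htlo
  obtain ⟨φ, hφ0, hφ1, hφ⟩ := exists_concat lam ht.le ht (fun s => ofMass (collapse m a t s))
    (fun s => ofMass (spread m b t s)) (by rw [hmid])
  simp only [hξ, hζ] at hφ0 hφ1 hφ
  refine ⟨φ, hφ0, hφ1, hφ.trans ?_⟩
  -- Surplus and deficit have equal total mass, so the surplus too is bounded by the excess of `ζ`.
  have hA : ENNReal.ofReal (∑' z, a z) ≤ excess ξ ζ := by
    rw [has.tsum_eq, ← hbs.tsum_eq, ENNReal.ofReal_tsum_of_nonneg hb0 hbs.summable]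
    exact ENNReal.tsum_le_tsum fun z => ENNReal.ofReal_le_ofReal
      (le_mul_of_one_le_right (hb0 z) (by linarith [theta_nonneg z]))
  have hhi : 0 ≤ hi := by
    have := (hb ξ).2 1 one_ne_zero
    linarith [this.1.trans this.2]
  rw [hξ] at h1
  calc _ ≤ (ENNReal.ofReal (4 / √(t * lo)) * excess ξ ζ + ENNReal.ofReal (2 * hi * t)) +
        (ENNReal.ofReal (8 - Real.log (t * lo)) * excess ξ ζ + ENNReal.ofReal (2 * hi * t)) :=
        add_le_add (h1.trans (by gcongr)) h2
    _ = _ := by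
      rw [show 4 * hi * t = 2 * hi * t + 2 * hi * t by ring,
        ENNReal.ofReal_add (by positivity) (by positivity)]
      ring

end Rates

/-! ### Smallness of the excess near a measure of finite moment -/

theorem tvDist_comm (ξ ζ : PMF ℕ) : tvDist ξ ζ = tvDist ζ ξ := by
  simp only [tvDist, abs_sub_comm]

theorem hasSum_mass_mul_theta {ξ : PMF ℕ} (h : ξ ∈ finiteMoment) :
    HasSum (fun z => mass ξ z * theta z) (thetaMoment ξ).toReal := by
  have h1 : ∀ z, (ξ z * ENNReal.ofReal (theta z)).toReal = mass ξ z * theta z := fun z => by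
    rw [ENNReal.toReal_mul, ENNReal.toReal_ofReal (theta_nonneg z), mass]
  have h2 : ∑' z, ξ z * ENNReal.ofReal (theta z) ≠ ∞ := ne_of_lt h
  have h3 := (ENNReal.summable_toReal h2).hasSum
  rw [← ENNReal.tsum_toReal_eq (ENNReal.ne_top_of_tsum_ne_top h2)] at h3
  simpa only [h1] using! h3

/-- Near a measure of finite moment, in total variation and in moment, the excess is small both
ways. -/
theorem exists_nbhd_excess_le {ξ : PMF ℕ} (hξ : ξ ∈ finiteMoment) {ε : ℝ} (hε : 0 < ε) :
    ∃ Δ : ℝ, 0 < Δ ∧ ∀ ζ ∈ nbhd ξ Δ,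
      excess ξ ζ ≤ ENNReal.ofReal ε ∧ excess ζ ξ ≤ ENNReal.ofReal ε := by
  have hx := hasSum_mass_mul_theta hξ
  -- Scheffé's argument: `a ≤ mass ξ`, so the moment of `a` beyond `N` is at most `ε / 4`, uniformly
  -- in `ζ`; below `N`, total variation controls it.
  obtain ⟨N, hN⟩ := ((tendsto_order.mp (tendsto_sum_nat_add fun z => mass ξ z * theta z)).2
    (ε / 4) (by positivity)).exists
  set B : ℝ := ∑ z ∈ Finset.range N, theta z with hB
  have hB0 : 0 ≤ B := Finset.sum_nonneg fun z _ => theta_nonneg z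
  refine ⟨ε / (8 * (B + 1)), by positivity, fun ζ hζ => ?_⟩
  obtain ⟨hζ1, hζ2, hζ3⟩ := hζ
  set Δ := ε / (8 * (B + 1)) with hΔ
  have hΔ0 : 0 < Δ := by positivity
  have hΔB : Δ * (B + 1) = ε / 8 := by
    rw [hΔ]
    field_simp
  have hy := hasSum_mass_mul_theta hζ1
  set a : ℕ → ℝ := fun z => mass ξ z - min (mass ζ z) (mass ξ z) with ha
  set b : ℕ → ℝ := fun z => mass ζ z - min (mass ξ z) (mass ζ z) with hb
  have ha0 : ∀ z, 0 ≤ a z := fun z => sub_nonneg.mpr (min_le_right _ _)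
  have hb0 : ∀ z, 0 ≤ b z := fun z => sub_nonneg.mpr (min_le_right _ _)
  have hax : ∀ z, a z ≤ mass ξ z := fun z =>
    sub_le_self _ (le_min (mass_nonneg _ _) (mass_nonneg _ _))
  have hby : ∀ z, b z ≤ mass ζ z := fun z =>
    sub_le_self _ (le_min (mass_nonneg _ _) (mass_nonneg _ _))
  have hba : ∀ z, b z - a z = mass ζ z - mass ξ z := fun z => by
    simp only [ha, hb, min_comm (mass ζ z)]
    ring
  have hab : ∀ z, |mass ξ z - mass ζ z| = a z + b z := fun z => by
    simp only [ha, hb, min_comm (mass ζ z)]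
    rcases le_total (mass ξ z) (mass ζ z) with h | h
    · rw [min_eq_left h, abs_of_nonpos (by linarith)]
      ring
    · rw [min_eq_right h, abs_of_nonneg (by linarith)]
      ring
  have has : Summable a := (summable_mass ξ).of_nonneg_of_le ha0 hax
  have hbs : Summable b := (summable_mass ζ).of_nonneg_of_le hb0 hby
  have habs : ∑' z, a z + ∑' z, b z ≤ 2 * Δ := by
    rw [← has.tsum_add hbs, ← tsum_congr hab]
    unfold tvDist at hζ2
    linarith
  have ha1 : 0 ≤ ∑' z, a z := tsum_nonneg ha0
  have hb1 : 0 ≤ ∑' z, b z := tsum_nonneg hb0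
  have haΔ : ∀ z, a z ≤ 2 * Δ := fun z => by
    have := has.le_tsum z fun y _ => ha0 y
    linarith
  have haθ : Summable fun z => a z * theta z :=
    hx.summable.of_nonneg_of_le (fun z => mul_nonneg (ha0 z) (theta_nonneg z))
      fun z => mul_le_mul_of_nonneg_right (hax z) (theta_nonneg z)
  have hbθ : Summable fun z => b z * theta z :=
    hy.summable.of_nonneg_of_le (fun z => mul_nonneg (hb0 z) (theta_nonneg z))
      fun z => mul_le_mul_of_nonneg_right (hby z) (theta_nonneg z)
  have h1 : ∑' z, a z * theta z ≤ 2 * Δ * B + ε / 4 := by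
    rw [← haθ.sum_add_tsum_nat_add N, hB, Finset.mul_sum]
    refine add_le_add (Finset.sum_le_sum fun z _ =>
      mul_le_mul_of_nonneg_right (haΔ z) (theta_nonneg z)) (le_trans ?_ hN.le)
    exact ((summable_nat_add_iff N).mpr haθ).tsum_le_tsum
      (fun z => mul_le_mul_of_nonneg_right (hax _) (theta_nonneg _))
      ((summable_nat_add_iff N).mpr hx.summable)
  -- The tail of `ζ` is not controlled directly; since `b - a` is the difference of the masses,
  -- closeness of the moments carries the bound from `a` to `b`.
  have h2 : ∑' z, b z * theta z ≤ ∑' z, a z * theta z + Δ := by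
    have h3 : ∑' z, b z * theta z - ∑' z, a z * theta z =
        (thetaMoment ζ).toReal - (thetaMoment ξ).toReal := by
      rw [← hbθ.tsum_sub haθ, ← (hy.sub hx).tsum_eq]
      exact tsum_congr fun z => by rw [← sub_mul, ← sub_mul, hba]
    have := (abs_le.mp hζ3).1
    linarith
  have key : ∀ c : ℕ → ℝ, (∀ z, 0 ≤ c z) → Summable c → (Summable fun z => c z * theta z) →
      ∑' z, c z ≤ 2 * Δ → ∑' z, c z * theta z ≤ 2 * Δ * B + ε / 4 + Δ →
      ∑' z, ENNReal.ofReal (c z * (1 + theta z)) ≤ ENNReal.ofReal ε := by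
    intro c hc hcs hcθ h3 h4
    have h5 := hcs.hasSum.add hcθ.hasSum
    have h6 : HasSum (fun z => c z * (1 + theta z)) (∑' z, c z + ∑' z, c z * theta z) :=
      h5.congr_fun fun z => by ring
    rw [← ENNReal.ofReal_tsum_of_nonneg (fun z => mul_nonneg (hc z) (by linarith [theta_nonneg z]))
      h6.summable, h6.tsum_eq]
    refine ENNReal.ofReal_le_ofReal ?_
    nlinarith
  exact ⟨key b hb0 hbs hbθ (by linarith) (by linarith),
    key a ha0 has haθ (by linarith) (by linarith)⟩

/-- Nearby measures are connected, in a short time and in both directions, at a small cost. -/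
theorem exists_small_cost_connection {lam : ℕ → ℕ → PMF ℕ → ℝ} (hbounds : RateBounds lam)
    {ξ : PMF ℕ} (hξ : ξ ∈ finiteMoment) {γ : ℝ} (hγ : 0 < γ) :
    ∃ T Δ : ℝ, 0 < T ∧ T < 1 ∧ 0 < Δ ∧ ∀ ζ ∈ nbhd ξ Δ,
      (∃ φ : ℝ → PMF ℕ, φ 0 = ξ ∧ φ T = ζ ∧ pathCost lam T φ ξ ≤ ENNReal.ofReal γ) ∧
      (∃ φ : ℝ → PMF ℕ, φ 0 = ζ ∧ φ T = ξ ∧ pathCost lam T φ ζ ≤ ENNReal.ofReal γ) := by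
  obtain ⟨lo, hi, hlo, hhi, hb⟩ := hbounds
  -- `t` is fixed first and absorbs the term independent of the excess; the neighbourhood may then
  -- depend on the large constant `C`. The bound `t + t < 1` leaves room for padding.
  obtain ⟨t, ht, htlo, ht1, hthi⟩ : ∃ t : ℝ, 0 < t ∧ t * lo ≤ 1 ∧ t + t < 1 ∧ 4 * hi * t ≤ γ / 2 := by
    refine ⟨min (1 / lo) (min (1 / 4) (γ / (8 * hi))), by positivity, ?_, ?_, ?_⟩
    · rw [← le_div_iff₀ hlo]
      exact min_le_left _ _
    · have : min (1 / lo) (min (1 / 4) (γ / (8 * hi))) ≤ 1 / 4 :=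
        (min_le_right _ _).trans (min_le_left _ _)
      linarith
    · have : min (1 / lo) (min (1 / 4) (γ / (8 * hi))) ≤ γ / (8 * hi) :=
        (min_le_right _ _).trans (min_le_right _ _)
      rw [le_div_iff₀ (by positivity)] at this
      linarith
  have hlog : Real.log (t * lo) ≤ 0 := Real.log_nonpos (by positivity) htlo
  set C : ℝ := 4 / √(t * lo) + (8 - Real.log (t * lo)) with hC
  have hC1 : 0 ≤ 4 / √(t * lo) := by positivity
  have hC0 : 0 < C := by linarith
  obtain ⟨Δ, hΔ, hex⟩ := exists_nbhd_excess_le hξ (show 0 < γ / (2 * C) by positivity)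
  have hfin : ∀ e : ℝ≥0∞, e ≤ ENNReal.ofReal (γ / (2 * C)) →
      (ENNReal.ofReal (4 / √(t * lo)) + ENNReal.ofReal (8 - Real.log (t * lo))) * e +
        ENNReal.ofReal (4 * hi * t) ≤ ENNReal.ofReal γ := fun e he => by
    rw [← ENNReal.ofReal_add hC1 (by linarith), ← hC]
    calc _ ≤ ENNReal.ofReal C * ENNReal.ofReal (γ / (2 * C)) + ENNReal.ofReal (γ / 2) := by gcongr
      _ = ENNReal.ofReal γ := by
        rw [← ENNReal.ofReal_mul hC0.le, ← ENNReal.ofReal_add (by positivity) (by positivity)]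
        congr 1
        field_simp
        ring
  refine ⟨t + t, Δ, by positivity, ht1, hΔ, fun ζ hζ => ⟨?_, ?_⟩⟩
  · obtain ⟨φ, h0, h1, h2⟩ := exists_path_pathCost_le hlo hb ht htlo ξ ζ
    exact ⟨φ, h0, h1, h2.trans (hfin _ (hex ζ hζ).1)⟩
  · obtain ⟨φ, h0, h1, h2⟩ := exists_path_pathCost_le hlo hb ht htlo ζ ξ
    exact ⟨φ, h0, h1, h2.trans (hfin _ (hex ζ hζ).2)⟩

/-! ### The quasipotential -/

theorem quasipotential_le_pathCost {lam : ℕ → ℕ → PMF ℕ → ℝ} {ξs ξ : PMF ℕ} {T : ℝ} (hT : 0 < T)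
    {φ : ℝ → PMF ℕ} (h0 : φ 0 = ξs) (h1 : φ T = ξ) :
    quasipotential lam ξs ξ ≤ pathCost lam T φ ξs :=
  iInf_le_of_le T <| iInf_le_of_le hT <| iInf_le_of_le φ <| iInf_le_of_le h0 <|
    iInf_le_of_le h1 le_rfl

/-- Triangle inequality: append `ψ` to every competitor for `ξ`. -/
theorem quasipotential_le_add {lam : ℕ → ℕ → PMF ℕ → ℝ} (ξs : PMF ℕ) {ξ ζ : PMF ℕ} {T : ℝ}
    (hT : 0 < T) {ψ : ℝ → PMF ℕ} (h0 : ψ 0 = ξ) (h1 : ψ T = ζ) :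
    quasipotential lam ξs ζ ≤ quasipotential lam ξs ξ + pathCost lam T ψ ξ := by
  conv_rhs => rw [quasipotential]
  simp only [ENNReal.iInf_add]
  refine le_iInf fun S => le_iInf fun hS => le_iInf fun φ => le_iInf fun hφ0 => le_iInf fun hφ1 => ?_
  obtain ⟨χ, hχ0, hχ1, hχ⟩ := exists_concat lam hS.le hT φ ψ (hφ1.trans h0.symm)
  rw [hφ0, h0] at hχ
  exact (quasipotential_le_pathCost (add_pos hS hT) (hχ0.trans hφ0) (hχ1.trans h1)).trans hχ

theorem pathCost_const {lam : ℕ → ℕ → PMF ℕ → ℝ} (hbounds : RateBounds lam) {ξs : PMF ℕ}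
    (hs : ∀ z, drift lam ξs z = 0) (T : ℝ) : pathCost lam T (fun _ => ξs) ξs = 0 := by
  obtain ⟨lo, hi, hlo, hhi, hb⟩ := hbounds
  have hac : IsAbsCont T fun _ => ξs := fun z => contDiffOn_const.absolutelyContinuousOnInterval
  have hc : localCost lam ξs (fun _ => 0) = 0 := by
    unfold localCost localFunctional
    simp only [hs, sub_self, mul_zero, Finsupp.sum, Finset.sum_const_zero, zero_sub, ENNReal.iSup_eq_zero,
      ENNReal.ofReal_eq_zero, Left.neg_nonpos_iff]
    intro α
    refine tsum_nonneg fun e => mul_nonneg (mul_nonneg (tau_nonneg _) ?_) (mass_nonneg _ _)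
    obtain ⟨⟨x, y⟩, he⟩ := e
    rcases he with h | ⟨h, h'⟩
    · simp only at h
      subst h
      exact le_trans (by positivity) ((hb ξs).1 x).1
    · simp only at h h'
      subst h'
      exact hlo.le.trans ((hb ξs).2 x h).1
  unfold pathCost
  rw [if_pos ⟨rfl, hac⟩]
  simp [hc]

/-- Also covers `a = ∞`, where the second bound forces `f i = ∞` eventually. -/
theorem tendsto_of_eventually_le_add {ι : Type*} {l : Filter ι} {f : ι → ℝ≥0∞} {a : ℝ≥0∞}
    (h : ∀ γ : ℝ, 0 < γ → ∀ᶠ i in l, f i ≤ a + ENNReal.ofReal γ ∧ a ≤ f i + ENNReal.ofReal γ) :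
    Tendsto f l (𝓝 a) := by
  by_cases ha : a = ∞
  · subst ha
    refine tendsto_const_nhds.congr' ?_
    filter_upwards [h 1 one_pos] with i hi
    by_contra hne
    exact absurd (top_le_iff.mp hi.2) (ENNReal.add_ne_top.mpr ⟨Ne.symm hne, ENNReal.ofReal_ne_top⟩)
  · rw [ENNReal.tendsto_nhds ha]
    intro ε hε
    by_cases hε' : ε = ∞
    · simp [hε']
    · have hε0 : 0 < ε.toReal := ENNReal.toReal_pos hε.ne' hε'
      filter_upwards [h _ hε0] with i hi
      rw [ENNReal.ofReal_toReal hε'] at hi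
      exact ⟨tsub_le_iff_right.mpr hi.2, hi.1⟩

/-- Connections from `ξ` to `ξn n` give the upper bound, those from `ξn n` back to `ξ` the lower
one. -/
theorem tendsto_quasipotential {lam : ℕ → ℕ → PMF ℕ → ℝ} (hbounds : RateBounds lam) (ξs : PMF ℕ)
    {ξn : ℕ → PMF ℕ} {ξ : PMF ℕ} (hn : ∀ n, ξn n ∈ finiteMoment) (hξ : ξ ∈ finiteMoment)
    (hd : Tendsto (fun n => tvDist (ξn n) ξ) atTop (𝓝 0))
    (hm : Tendsto (fun n => thetaMoment (ξn n)) atTop (𝓝 (thetaMoment ξ))) :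
    Tendsto (fun n => quasipotential lam ξs (ξn n)) atTop (𝓝 (quasipotential lam ξs ξ)) := by
  refine tendsto_of_eventually_le_add fun γ hγ => ?_
  obtain ⟨T, Δ, hT, -, hΔ, hcon⟩ := exists_small_cost_connection hbounds hξ hγ
  have hm' := (ENNReal.tendsto_toReal (ne_of_lt hξ)).comp hm
  filter_upwards [(tendsto_order.mp hd).2 Δ hΔ, Metric.tendsto_nhds.mp hm' Δ hΔ] with n h1 h2
  rw [dist_comm, Real.dist_eq] at h2
  obtain ⟨⟨φ, hφ0, hφ1, hφ⟩, ψ, hψ0, hψ1, hψ⟩ :=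
    hcon (ξn n) ⟨hn n, tvDist_comm ξ (ξn n) ▸ h1.le, h2.le⟩
  exact ⟨(quasipotential_le_add ξs hT hφ0 hφ1).trans (add_le_add le_rfl hφ),
    (quasipotential_le_add ξs hT hψ0 hψ1).trans (add_le_add le_rfl hψ)⟩

end MeanField

theorem mainTheorem6
    (lam : ℕ → ℕ → PMF ℕ → ℝ)
    (hbounds : MeanField.RateBounds lam)
    (hlip : MeanField.RateLipschitz lam)
    (ξs : PMF ℕ)
    (hstable : MeanField.IsUniqueStableEquilibrium lam ξs)
    (hmoment : MeanField.MomentConvergence lam ξs) :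
    (∀ (ξn : ℕ → PMF ℕ) (ξ : PMF ℕ),
      (∀ n, ξn n ∈ MeanField.finiteMoment) → ξ ∈ MeanField.finiteMoment →
      Tendsto (fun n => MeanField.tvDist (ξn n) ξ) atTop (𝓝 0) →
      Tendsto (fun n => MeanField.thetaMoment (ξn n)) atTop (𝓝 (MeanField.thetaMoment ξ)) →
      Tendsto (fun n => MeanField.quasipotential lam ξs (ξn n)) atTop
        (𝓝 (MeanField.quasipotential lam ξs ξ))) ∧
    MeanField.quasipotential lam ξs ξs = 0 ∧
    (∃ T : ℝ, 0 < T ∧ ∀ γ : ℝ, 0 < γ → ∃ Δ : ℝ, 0 < Δ ∧ ∀ ζ ∈ MeanField.nbhd ξs Δ,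
      ∃ φ : ℝ → PMF ℕ, φ 0 = ξs ∧ φ T = ζ ∧
        MeanField.pathCost lam T φ ξs ≤ ENNReal.ofReal γ) := by
  have hconst := MeanField.pathCost_const hbounds hstable.1.1
  refine ⟨fun ξn ξ hn hξ hd hm => MeanField.tendsto_quasipotential hbounds ξs hn hξ hd hm, ?_,
    1, one_pos, fun γ hγ => ?_⟩
  · refine nonpos_iff_eq_zero.mp ?_
    exact (MeanField.quasipotential_le_pathCost (φ := fun _ => ξs) one_pos rfl rfl).trans (hconst 1).le
  · obtain ⟨T, Δ, hT, hT1, hΔ, hcon⟩ :=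
      MeanField.exists_small_cost_connection hbounds hmoment.1 hγ
    refine ⟨Δ, hΔ, fun ζ hζ => ?_⟩
    obtain ⟨⟨φ, hφ0, hφ1, hφ⟩, -⟩ := hcon ζ hζ
    -- Waiting at `ξs` for time `1 - T` is free, so the total time `1` does not depend on `γ`.
    obtain ⟨χ, hχ0, hχ1, hχ⟩ := MeanField.exists_concat lam (sub_nonneg.mpr hT1.le) hT
      (fun _ => ξs) φ hφ0.symm
    rw [sub_add_cancel] at hχ1 hχ
    refine ⟨χ, hχ0, hχ1.trans hφ1, hχ.trans ?_⟩
    rw [hconst, zero_add, hφ0]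
    exact hφ
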